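/- Let $K$ be a field of characteristic $0$; all algebras are (not necessarily associative or unital) algebras over $K$. A Zinbiel algebra is an algebra $(A,\circ)$ satisfying $a\circ(b\circ c)=(a\circ b+b\circ a)\circ c$ for all $a,b,c\in A$; its minus-algebra $A^{(-)}$ is the vector space $A$ with the product $[a,b]=a\circ b-b\circ a$. A Tortkara algebra is an anticommutative algebra satisfying $(ab)(cb)=J(a,b,c)\,b$ for all $a,b,c$, where $J(a,b,c)=(ab)c+(bc)a+(ca)b$. Theorem. Every Tortkara algebra $B$ over $K$ that is generated as an algebra by two elements is special: there exist a Zinbiel algebra $A$ over $K$ and an injective algebra homomorphism $B\to A^{(-)}$. -/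

import Mathlib

universe u v

/-- A (right-)Zinbiel algebra: `a ∘ (b ∘ c) = (a ∘ b + b ∘ a) ∘ c`. The ambient structure is that of
a nonassociative algebra; the product is written `*`. -/
def IsZinbiel (A : Type*) [NonUnitalNonAssocRing A] : Prop :=
  ∀ a b c : A, a * (b * c) = (a * b + b * a) * c

/-- The Jacobian `J(a, b, c) = (ab)c + (bc)a + (ca)b`. -/
def jacobian {B : Type*} [NonUnitalNonAssocRing B] (a b c : B) : B :=
  a * b * c + b * c * a + c * a * b

/-- A Tortkara algebra: an anticommutative algebra with `(ab)(cb) = J(a, b, c) b`. -/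
structure IsTortkara (B : Type*) [NonUnitalNonAssocRing B] : Prop where
  anticomm : ∀ a b : B, a * b = -(b * a)
  tortkara : ∀ a b c : B, (a * b) * (c * b) = jacobian a b c * b

/-- The minus-algebra `A⁽⁻⁾`: the same vector space as `A`, with the commutator product
`[x, y] = x ∘ y - y ∘ x`. -/
def MinusAlgebra (A : Type*) : Type _ := A

namespace MinusAlgebra

variable {A : Type*}

/-- The identity map `A → A⁽⁻⁾`. -/
def of : A ≃ MinusAlgebra A := Equiv.refl A

instance [NonUnitalNonAssocRing A] : AddCommGroup (MinusAlgebra A) :=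
  inferInstanceAs (AddCommGroup A)

instance [NonUnitalNonAssocRing A] : Mul (MinusAlgebra A) where
  mul x y := of (of.symm x * of.symm y - of.symm y * of.symm x)

theorem of_add [NonUnitalNonAssocRing A] (x y : A) : of (x + y) = of x + of y := rfl

theorem of_mul_of [NonUnitalNonAssocRing A] (x y : A) :
    of x * of y = of (x * y - y * x) := rfl

theorem of_symm_mul [NonUnitalNonAssocRing A] (x y : MinusAlgebra A) :
    of.symm (x * y) = of.symm x * of.symm y - of.symm y * of.symm x := rfl

theorem of_symm_add [NonUnitalNonAssocRing A] (x y : MinusAlgebra A) :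
    of.symm (x + y) = of.symm x + of.symm y := rfl

theorem of_symm_zero [NonUnitalNonAssocRing A] : of.symm (0 : MinusAlgebra A) = (0 : A) := rfl

instance [NonUnitalNonAssocRing A] : NonUnitalNonAssocRing (MinusAlgebra A) where
  left_distrib x y z := by
    apply of.symm.injective
    simp only [of_symm_mul, of_symm_add, mul_add, add_mul]
    abel
  right_distrib x y z := by
    apply of.symm.injective
    simp only [of_symm_mul, of_symm_add, mul_add, add_mul]
    abel
  zero_mul x := by
    apply of.symm.injective
    simp only [of_symm_mul, of_symm_zero, mul_zero, zero_mul, sub_zero]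
  mul_zero x := by
    apply of.symm.injective
    simp only [of_symm_mul, of_symm_zero, mul_zero, zero_mul, sub_zero]

instance {K : Type*} [Semiring K] [NonUnitalNonAssocRing A] [Module K A] :
    Module K (MinusAlgebra A) :=
  inferInstanceAs (Module K A)

theorem of_smul {K : Type*} [Semiring K] [NonUnitalNonAssocRing A] [Module K A] (k : K) (x : A) :
    of (k • x) = k • of x := rfl

end MinusAlgebra

/-- An algebra `B` over `K` is special if, for some Zinbiel algebra `A` over `K`, it is
(isomorphic to) a subalgebra of the minus-algebra `A⁽⁻⁾`, i.e. there is an injective algebra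
homomorphism `B → A⁽⁻⁾`. -/
def IsSpecial (K : Type u) (B : Type v) [Field K] [NonUnitalNonAssocRing B] [Module K B] : Prop :=
  ∃ (A : Type (max u v)) (_ : NonUnitalNonAssocRing A) (_ : Module K A)
    (_ : IsScalarTower K A A) (_ : SMulCommClass K A A),
    IsZinbiel A ∧ ∃ φ : B →ₙₐ[K] MinusAlgebra A, Function.Injective φ

/-!
The polynomials in letters `x t`, with the half-shuffle `∫ a db` as product, form the free Zinbiel
algebra; its minus-algebra has the product `area a b = ∫ a db - b da`. Over two letters, the
elements generated from the letters by `area` are those with antisymmetric second derivatives: up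
to a linear part they are the series `curl u`, the commutator of the two operators of appending a
letter.

Let `B` be generated by `g true` and `g false`, and let `P` be the subalgebra generated by the pairs
`(x t, g t)`. Then `P → areaSubmodule` is bijective. It is injective because `P` is spanned by the
letters and the left-normed monomials, and because bracketing `curl u` with `x t` replaces `u` by
`-(x t * u + app t u) = -(E + 1) (app t u)`, where `app` appends a letter and `E = ∑ x t * ∂ t` is
the Euler derivation; `E + 1` is invertible in each degree, as the eigenvalues of `E` are natural
numbers and the characteristic is zero. So `B` is the quotient of `areaSubmodule` by the image `I`
of the kernel of `P → B`, an ideal for `area`.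

The invertibility of `E + c` for `c = 1, 2` also shows that the ideal of the shuffle algebra
generated by `I` is an ideal for the half-shuffle, and that it meets `areaSubmodule` only in `I`.
Hence `B` embeds into the minus-algebra of the quotient of the free Zinbiel algebra by this ideal.
-/

/-! ### Left-normed monomials in Tortkara algebras -/

/-- The left-normed monomials `((g true * g false) * g t₁) * ⋯`; the last factor comes first in the
list. -/
def leftNormed {P : Type*} [Mul P] (g : Bool → P) : List Bool → P
  | [] => g true * g false
  | t :: w => leftNormed g w * g t

/-- The span of the left-normed monomials of length at least two. -/
def leftNormedSpan (K : Type*) {P : Type*} [Semiring K] [NonUnitalNonAssocRing P] [Module K P]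
    (g : Bool → P) : Submodule K P :=
  Submodule.span K (Set.range (leftNormed g))

theorem mul_mem_leftNormedSpan {K P : Type*} [Semiring K] [NonUnitalNonAssocRing P] [Module K P]
    [IsScalarTower K P P] {g : Bool → P} {p : P} (hp : p ∈ leftNormedSpan K g) (t : Bool) :
    p * g t ∈ leftNormedSpan K g := by
  induction hp using Submodule.span_induction with
  | mem p hp =>
    obtain ⟨w, rfl⟩ := hp
    exact Submodule.subset_span ⟨t :: w, rfl⟩
  | zero => rw [zero_mul]; exact zero_mem _
  | add p q _ _ hp hq => rw [add_mul]; exact add_mem hp hq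
  | smul c p _ hp => rw [smul_mul_assoc]; exact Submodule.smul_mem _ _ hp

theorem mul_mem_of_mul_leftNormed_mem {K P : Type*} [Semiring K] [NonUnitalNonAssocRing P]
    [Module K P] [SMulCommClass K P P] {g : Bool → P} {a p : P} {S : Submodule K P}
    (h : ∀ w, a * leftNormed g w ∈ S) (hp : p ∈ leftNormedSpan K g) : a * p ∈ S := by
  induction hp using Submodule.span_induction with
  | mem p hp => obtain ⟨w, rfl⟩ := hp; exact h w
  | zero => rw [mul_zero]; exact zero_mem _
  | add p q _ _ hp hq => rw [mul_add]; exact add_mem hp hq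
  | smul c p _ hp => rw [mul_smul_comm]; exact Submodule.smul_mem _ _ hp

/-- The span of the left-normed monomials with fewer than `n` factors after `g true * g false`. -/
def leftNormedSpanLT (K : Type*) {P : Type*} [Semiring K] [NonUnitalNonAssocRing P] [Module K P]
    (g : Bool → P) (n : ℕ) : Submodule K P :=
  Submodule.span K (leftNormed g '' {w | w.length < n})

section LeftNormedSpanLT

variable {K P : Type*} [Semiring K] [NonUnitalNonAssocRing P] [Module K P] {g : Bool → P}

theorem leftNormed_mem_leftNormedSpanLT {n : ℕ} {w : List Bool} (hw : w.length < n) :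
    leftNormed g w ∈ leftNormedSpanLT K g n :=
  Submodule.subset_span ⟨w, hw, rfl⟩

theorem leftNormedSpanLT_mono : Monotone (leftNormedSpanLT K g) := fun _ _ hmn =>
  Submodule.span_mono (Set.image_mono fun _ hw => lt_of_lt_of_le hw hmn)

theorem leftNormedSpanLT_le (n : ℕ) : leftNormedSpanLT K g n ≤ leftNormedSpan K g :=
  Submodule.span_mono (Set.image_subset_range _ _)

theorem exists_mem_leftNormedSpanLT {p : P} (hp : p ∈ leftNormedSpan K g) :
    ∃ n, p ∈ leftNormedSpanLT K g n := by
  rw [← Submodule.mem_iSup_of_directed _ leftNormedSpanLT_mono.directed_le]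
  refine Submodule.span_le.2 ?_ hp
  rintro _ ⟨w, rfl⟩
  exact Submodule.mem_iSup_of_mem (w.length + 1)
    (leftNormed_mem_leftNormedSpanLT (Nat.lt_succ_self _))

theorem exists_eq_smul_add_sum_mul [IsScalarTower K P P] {n : ℕ} {p : P}
    (hp : p ∈ leftNormedSpanLT K g (n + 1)) : ∃ (c : K) (q : Bool → P),
      (∀ t, q t ∈ leftNormedSpanLT K g n) ∧ p = c • leftNormed g [] + ∑ t, q t * g t := by
  induction hp using Submodule.span_induction with
  | mem p hp =>
    obtain ⟨_ | ⟨t, w⟩, hw, rfl⟩ := hp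
    · exact ⟨1, 0, fun _ => zero_mem _, by simp⟩
    · refine ⟨0, Pi.single t (leftNormed g w), fun s => ?_, ?_⟩
      · rcases eq_or_ne s t with rfl | hst
        · rw [Pi.single_eq_same]
          exact leftNormed_mem_leftNormedSpanLT (Nat.lt_of_succ_lt_succ hw)
        · rw [Pi.single_eq_of_ne hst]
          exact zero_mem _
      · cases t <;> simp [leftNormed]
  | zero => exact ⟨0, 0, fun _ => zero_mem _, by simp⟩
  | add p p' _ _ hp hp' =>
    obtain ⟨c, q, hq, rfl⟩ := hp
    obtain ⟨c', q', hq', rfl⟩ := hp'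
    refine ⟨c + c', q + q', fun t => add_mem (hq t) (hq' t), ?_⟩
    simp only [Pi.add_apply, add_mul, add_smul, Finset.sum_add_distrib]
    abel
  | smul a p _ hp =>
    obtain ⟨c, q, hq, rfl⟩ := hp
    refine ⟨a * c, a • q, fun t => Submodule.smul_mem _ a (hq t), ?_⟩
    simp only [Pi.smul_apply, smul_mul_assoc, smul_add, mul_smul, Finset.smul_sum]

end LeftNormedSpanLT

namespace IsTortkara

theorem prod {P Q : Type*} [NonUnitalNonAssocRing P] [NonUnitalNonAssocRing Q]
    (hP : IsTortkara P) (hQ : IsTortkara Q) : IsTortkara (P × Q) where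
  anticomm _ _ := Prod.ext (hP.anticomm _ _) (hQ.anticomm _ _)
  tortkara _ _ _ := Prod.ext (hP.tortkara _ _ _) (hQ.tortkara _ _ _)

variable {P : Type*} [NonUnitalNonAssocRing P] (h : IsTortkara P)

include h

theorem tortkara_linearized (a b c d : P) :
    (a * b) * (c * d) + (a * d) * (c * b) = jacobian a b c * d + jacobian a d c * b := by
  have hsum := h.tortkara a (b + d) c
  have hjac : jacobian a (b + d) c = jacobian a b c + jacobian a d c := by
    simp only [jacobian, mul_add, add_mul]; abel
  rw [hjac] at hsum
  simp only [mul_add, add_mul] at hsum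
  rw [h.tortkara a b c, h.tortkara a d c] at hsum
  rw [← sub_eq_zero, ← sub_eq_zero.2 hsum]
  abel

theorem mul_self (K : Type*) [Field K] [NeZero (2 : K)] [Module K P] (a : P) : a * a = 0 := by
  have htwo : (2 : K) • (a * a) = 0 := by
    rw [two_smul]; nth_rw 1 [h.anticomm]; exact neg_add_cancel _
  exact (smul_eq_zero.1 htwo).resolve_left two_ne_zero

variable {K : Type*} [Field K] [NeZero (2 : K)] [Module K P]

variable [IsScalarTower K P P] {g : Bool → P}

theorem generator_mul_generator_mul_leftNormed_mem (w : List Bool) (s t : Bool) :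
    g s * g t * leftNormed g w ∈ leftNormedSpan K g := by
  induction w generalizing s t with
  | nil =>
    suffices h0 : g s * g t * leftNormed g [] = 0 from h0 ▸ zero_mem _
    cases s <;> cases t <;> simp only [leftNormed, h.mul_self K, zero_mul]
    rw [h.anticomm (g false), neg_mul, h.mul_self K, neg_zero]
  | cons r w ih =>
    have hw (t : Bool) : leftNormed g w * g t ∈ leftNormedSpan K g :=
      Submodule.subset_span ⟨t :: w, rfl⟩
    have hr (s : Bool) : g s * g r * (leftNormed g w * g r) ∈ leftNormedSpan K g := by
      rw [h.tortkara, jacobian, h.anticomm (g r), neg_mul]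
      exact mul_mem_leftNormedSpan (add_mem (add_mem (ih s r)
        (neg_mem (mul_mem_leftNormedSpan (hw r) s))) (mul_mem_leftNormedSpan (hw s) r)) r
    rw [leftNormed]
    rcases eq_or_ne t r with rfl | htr
    · exact hr s
    rcases eq_or_ne s r with rfl | hsr
    · rw [h.anticomm (g s), neg_mul]
      exact neg_mem (hr t)
    · obtain rfl : s = t := by rw [Bool.eq_not.2 hsr, Bool.eq_not.2 htr]
      rw [h.mul_self K, zero_mul]
      exact zero_mem _

variable [SMulCommClass K P P]

theorem generator_mul_generator_mul_mem (s t : Bool) {p : P} (hp : p ∈ leftNormedSpan K g) :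
    g s * g t * p ∈ leftNormedSpan K g :=
  mul_mem_of_mul_leftNormed_mem (h.generator_mul_generator_mul_leftNormed_mem · s t) hp

theorem mul_generator_mul_mul_generator (a b : P) (s t : Bool) :
    a * g s * (b * g t) = -(g s * g t * (a * b)) - jacobian (g s) a b * g t +
      a * jacobian (g s) (g t) b := by
  rw [h.anticomm a (g s), neg_mul, h.anticomm a (jacobian _ _ _), h.anticomm a b, mul_neg,
    eq_sub_of_add_eq (h.tortkara_linearized (g s) a b (g t))]
  abel

theorem mul_generator_mul_leftNormed_mem {a : P} (ha : a ∈ leftNormedSpan K g)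
    (hmul : ∀ p ∈ leftNormedSpan K g, a * p ∈ leftNormedSpan K g) (s : Bool) (w : List Bool) :
    a * g s * leftNormed g w ∈ leftNormedSpan K g := by
  have hg {p : P} (hp : p ∈ leftNormedSpan K g) (t : Bool) : p * g t ∈ leftNormedSpan K g :=
    mul_mem_leftNormedSpan hp t
  induction w generalizing s with
  | nil =>
    rw [h.anticomm]
    exact neg_mem (h.generator_mul_generator_mul_mem true false (hg ha s))
  | cons t w ih =>
    have hw : leftNormed g w ∈ leftNormedSpan K g := Submodule.subset_span ⟨w, rfl⟩
    rw [leftNormed, h.mul_generator_mul_mul_generator]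
    refine add_mem (sub_mem (neg_mem ?_) (hg (add_mem (add_mem ?_ ?_) ?_) t))
      (hmul _ (add_mem (add_mem ?_ ?_) ?_))
    · exact h.generator_mul_generator_mul_mem s t (hmul _ hw)
    · rw [h.anticomm (g s), neg_mul]
      exact neg_mem (ih s)
    · exact hg (hmul _ hw) s
    · rw [h.anticomm]
      exact neg_mem (hmul _ (hg hw s))
    · exact h.generator_mul_generator_mul_mem s t hw
    · rw [h.anticomm (g t), neg_mul]
      exact neg_mem (hg (hg hw t) s)
    · exact hg (hg hw s) t

theorem leftNormed_mul_mem (w : List Bool) {p : P} (hp : p ∈ leftNormedSpan K g) :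
    leftNormed g w * p ∈ leftNormedSpan K g := by
  induction w generalizing p with
  | nil => exact h.generator_mul_generator_mul_mem true false hp
  | cons s w ih =>
    exact mul_mem_of_mul_leftNormed_mem (h.mul_generator_mul_leftNormed_mem
      (Submodule.subset_span ⟨w, rfl⟩) (fun _ => ih) s) hp

theorem map₂_mul_sup_leftNormedSpan_le :
    Submodule.map₂ (LinearMap.mul K P) (Submodule.span K (Set.range g) ⊔ leftNormedSpan K g)
      (Submodule.span K (Set.range g) ⊔ leftNormedSpan K g) ≤ leftNormedSpan K g := by
  have hmem (w : List Bool) : leftNormed g w ∈ leftNormedSpan K g := Submodule.subset_span ⟨w, rfl⟩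
  rw [leftNormedSpan, ← Submodule.span_union, Submodule.map₂_span_span, Submodule.span_le]
  rintro _ ⟨_, ⟨s, rfl⟩ | ⟨u, rfl⟩, _, ⟨t, rfl⟩ | ⟨w, rfl⟩, rfl⟩
  · change g s * g t ∈ leftNormedSpan K g
    cases s <;> cases t
    · rw [h.mul_self K]; exact zero_mem _
    · rw [h.anticomm]; exact neg_mem (hmem [])
    · exact hmem []
    · rw [h.mul_self K]; exact zero_mem _
  · change g s * leftNormed g w ∈ leftNormedSpan K g
    rw [h.anticomm]; exact neg_mem (hmem (s :: w))
  · exact hmem (t :: u)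
  · exact h.leftNormed_mul_mem u (hmem w)

theorem adjoin_range_le_sup_leftNormedSpan :
    (NonUnitalAlgebra.adjoin K (Set.range g)).toSubmodule ≤
      Submodule.span K (Set.range g) ⊔ leftNormedSpan K g := by
  intro p hp
  induction hp using NonUnitalAlgebra.adjoin_induction with
  | mem p hp => exact Submodule.mem_sup_left (Submodule.subset_span hp)
  | zero => exact zero_mem _
  | add p q _ _ hp hq => exact add_mem hp hq
  | smul c p _ hp => exact Submodule.smul_mem _ c hp
  | mul p q _ _ hp hq =>
    exact Submodule.mem_sup_right
      (h.map₂_mul_sup_leftNormedSpan_le (Submodule.apply_mem_map₂ _ hp hq))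

end IsTortkara

/-! ### Zinbiel algebras, minus-algebras and quotients -/

theorem IsZinbiel.isTortkara_minusAlgebra {A : Type*} [NonUnitalNonAssocRing A]
    (hA : IsZinbiel A) : IsTortkara (MinusAlgebra A) where
  anticomm a b := (neg_sub (MinusAlgebra.of.symm b * MinusAlgebra.of.symm a) _).symm
  tortkara a b c := MinusAlgebra.of.symm.injective <| by
    simp only [jacobian, MinusAlgebra.of_symm_mul, MinusAlgebra.of_symm_add]
    simp only [hA _ _ _, mul_add, add_mul, mul_sub, sub_mul]
    abel

theorem IsZinbiel.of_surjective {A Q F : Type*} [NonUnitalNonAssocRing A]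
    [NonUnitalNonAssocRing Q] [FunLike F A Q] [NonUnitalRingHomClass F A Q] (hA : IsZinbiel A)
    {π : F} (hπ : Function.Surjective π) : IsZinbiel Q := by
  intro a b c
  obtain ⟨⟨a, rfl⟩, ⟨b, rfl⟩, c, rfl⟩ := And.intro (hπ a) (And.intro (hπ b) (hπ c))
  simp only [← map_mul, ← map_add, hA a b c]

namespace MinusAlgebra

variable {K A : Type*} [Semiring K] [NonUnitalNonAssocRing A] [Module K A]

instance [IsScalarTower K A A] [SMulCommClass K A A] :
    IsScalarTower K (MinusAlgebra A) (MinusAlgebra A) where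
  smul_assoc c x y := by
    change (c • of.symm x) * of.symm y - of.symm y * (c • of.symm x) =
      c • (of.symm x * of.symm y - of.symm y * of.symm x)
    rw [smul_mul_assoc, mul_smul_comm, smul_sub]

instance [IsScalarTower K A A] [SMulCommClass K A A] :
    SMulCommClass K (MinusAlgebra A) (MinusAlgebra A) where
  smul_comm c x y := by
    change c • (of.symm x * of.symm y - of.symm y * of.symm x) =
      of.symm x * (c • of.symm y) - (c • of.symm y) * of.symm x
    rw [smul_mul_assoc, mul_smul_comm, smul_sub]

/-- The homomorphism of minus-algebras given by a homomorphism of algebras. -/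
def map {Q : Type*} [NonUnitalNonAssocRing Q] [Module K Q] (π : A →ₙₐ[K] Q) :
    MinusAlgebra A →ₙₐ[K] MinusAlgebra Q where
  toFun x := of (π (of.symm x))
  map_smul' c x := congrArg of (map_smul π c (of.symm x))
  map_zero' := congrArg of (map_zero π)
  map_add' x y := congrArg of (map_add π (of.symm x) (of.symm y))
  map_mul' x y := by rw [of_symm_mul, map_sub, map_mul, map_mul]; rfl

end MinusAlgebra

/-- The product on the quotient of an algebra by a two-sided ideal. -/
def quotientMul {K A : Type*} [CommRing K] [NonUnitalNonAssocRing A] [Module K A]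
    [IsScalarTower K A A] [SMulCommClass K A A] (N : Submodule K A)
    (hl : ∀ a, ∀ n ∈ N, a * n ∈ N) (hr : ∀ n ∈ N, ∀ a, n * a ∈ N) :
    (A ⧸ N) →ₗ[K] (A ⧸ N) →ₗ[K] (A ⧸ N) :=
  ((LinearMap.mul K A).compr₂ N.mkQ).liftQ₂ N N
    (fun n hn => LinearMap.ext fun a => (Submodule.Quotient.mk_eq_zero N).2 (hr n hn a))
    (fun n hn => LinearMap.ext fun a => (Submodule.Quotient.mk_eq_zero N).2 (hl a n hn))

theorem exists_surjective_nonUnitalAlgHom_of_ideal {K : Type*} {A : Type u} [CommRing K]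
    [NonUnitalNonAssocRing A] [Module K A] [IsScalarTower K A A] [SMulCommClass K A A]
    (N : Submodule K A) (hl : ∀ a, ∀ n ∈ N, a * n ∈ N) (hr : ∀ n ∈ N, ∀ a, n * a ∈ N) :
    ∃ (Q : Type u) (_ : NonUnitalNonAssocRing Q) (_ : Module K Q) (_ : IsScalarTower K Q Q)
      (_ : SMulCommClass K Q Q) (π : A →ₙₐ[K] Q),
      Function.Surjective π ∧ ∀ a, π a = 0 ↔ a ∈ N := by
  let ring : NonUnitalNonAssocRing (A ⧸ N) :=
    { (inferInstance : AddCommGroup (A ⧸ N)) with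
      mul := fun x y => quotientMul N hl hr x y
      left_distrib := fun x => map_add (quotientMul N hl hr x)
      right_distrib := LinearMap.map_add₂ (quotientMul N hl hr)
      zero_mul := LinearMap.map_zero₂ (quotientMul N hl hr)
      mul_zero := fun x => map_zero (quotientMul N hl hr x) }
  exact ⟨A ⧸ N, ring, inferInstance, ⟨LinearMap.map_smul₂ (quotientMul N hl hr)⟩,
    ⟨fun c x y => (map_smul (quotientMul N hl hr x) c y).symm⟩,
    { N.mkQ with map_mul' := fun _ _ => rfl, map_zero' := rfl },
    N.mkQ_surjective, fun _ => Submodule.Quotient.mk_eq_zero N⟩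

theorem exists_injective_nonUnitalAlgHom_of_surjective {K P B Q : Type*} [Semiring K]
    [NonUnitalNonAssocRing P] [Module K P] [NonUnitalNonAssocRing B] [Module K B]
    [NonUnitalNonAssocRing Q] [Module K Q] {φ : P →ₙₐ[K] B} (hφ : Function.Surjective φ)
    {ψ : P →ₙₐ[K] Q} (h : ∀ p, ψ p = 0 ↔ φ p = 0) :
    ∃ f : B →ₙₐ[K] Q, Function.Injective f := by
  have heq {p q : P} : ψ p = ψ q ↔ φ p = φ q := by
    rw [← sub_eq_zero, ← map_sub, h, map_sub, sub_eq_zero]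
  choose r hr using hφ
  exact ⟨{  toFun := fun b => ψ (r b)
            map_smul' := fun c b => by rw [← map_smul, heq]; simp [hr]
            map_zero' := by rw [← map_zero ψ, heq]; simp [hr]
            map_add' := fun b c => by rw [← map_add, heq]; simp [hr]
            map_mul' := fun b c => by rw [← map_mul, heq]; simp [hr] },
    fun b c hbc => by rw [← hr b, ← hr c, ← heq]; exact hbc⟩

theorem surjective_comp_subtype_adjoin {K P B : Type*} [CommSemiring K] [NonUnitalNonAssocRing P]
    [Module K P] [IsScalarTower K P P] [SMulCommClass K P P] [NonUnitalNonAssocRing B] [Module K B]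
    [IsScalarTower K B B] [SMulCommClass K B B] {φ : P →ₙₐ[K] B} {s : Set P}
    (h : NonUnitalAlgebra.adjoin K (φ '' s) = ⊤) : Function.Surjective
      (φ.comp (NonUnitalSubalgebraClass.subtype (NonUnitalAlgebra.adjoin K s))) := fun b => by
  obtain ⟨p, hp, rfl⟩ : b ∈ (NonUnitalAlgebra.adjoin K s).map φ := by
    rw [NonUnitalAlgHom.map_adjoin, h]
    exact NonUnitalAlgebra.mem_top
  exact ⟨⟨p, hp⟩, rfl⟩

theorem IsZinbiel.isSpecial {K : Type u} {A : Type u} {B : Type v} [Field K]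
    [NonUnitalNonAssocRing A] [Module K A] [IsScalarTower K A A] [SMulCommClass K A A]
    [NonUnitalNonAssocRing B] [Module K B] (hA : IsZinbiel A) {φ : B →ₙₐ[K] MinusAlgebra A}
    (hφ : Function.Injective φ) : IsSpecial K B := by
  let up : A →ₙₐ[K] ULift.{v} A :=
    { toFun := ULift.up, map_smul' := fun _ _ => rfl, map_zero' := rfl,
      map_add' := fun _ _ => rfl, map_mul' := fun _ _ => rfl }
  exact ⟨ULift.{v} A, inferInstance, inferInstance, inferInstance,
    ⟨fun c x y => congrArg ULift.up (smul_comm c x.down y.down)⟩,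
    hA.of_surjective (π := up) ULift.up_surjective, (MinusAlgebra.map up).comp φ,
    ULift.up_injective.comp hφ⟩

/-! ### The shuffle algebra -/

/-- Formal series over the alphabet `α`, as coefficient functions on words; they form a commutative
ring under the shuffle product. A word is stored with its last letter at the head of the list. -/
def ShuffleSeries (α R : Type*) : Type _ := List α → R

namespace ShuffleSeries

section CommRing

variable {α R : Type*} [CommRing R]

instance : AddCommGroup (ShuffleSeries α R) := inferInstanceAs (AddCommGroup (List α → R))

instance : Module R (ShuffleSeries α R) := inferInstanceAs (Module R (List α → R))

/-- The coefficient of a word in a series. -/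
def coeff (w : List α) : ShuffleSeries α R →ₗ[R] R where
  toFun f := f w
  map_add' _ _ := rfl
  map_smul' _ _ := rfl

@[ext] theorem ext {f g : ShuffleSeries α R} (h : ∀ w, coeff w f = coeff w g) : f = g := funext h

/-- The constant term of a series, i.e. the augmentation of the shuffle algebra. -/
def aug : ShuffleSeries α R →ₗ[R] R := coeff []

/-- The derivation `∂ₜ` of the shuffle algebra: it removes the last letter of the words ending in
`t` and kills the other words. -/
def der (t : α) : ShuffleSeries α R →ₗ[R] ShuffleSeries α R where
  toFun f w := coeff (t :: w) f
  map_add' _ _ := rfl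
  map_smul' _ _ := rfl

theorem coeff_nil (f : ShuffleSeries α R) : coeff [] f = aug f := rfl

theorem coeff_cons (t : α) (w : List α) (f : ShuffleSeries α R) :
    coeff (t :: w) f = coeff w (der t f) := rfl

theorem ext_der {f g : ShuffleSeries α R} (haug : aug f = aug g) (hder : ∀ t, der t f = der t g) :
    f = g := by
  ext w
  cases w with
  | nil => exact haug
  | cons t w => exact congrArg (coeff w) (hder t)

/-- The coefficients of the shuffle product, computed from the Leibniz rule for `∂ₜ`. -/
def shuffleCoeff : List α → ShuffleSeries α R → ShuffleSeries α R → R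
  | [], f, g => aug f * aug g
  | t :: w, f, g => shuffleCoeff w (der t f) g + shuffleCoeff w f (der t g)

instance : Mul (ShuffleSeries α R) := ⟨fun f g w => shuffleCoeff w f g⟩

instance : One (ShuffleSeries α R) := ⟨fun | [] => 1 | _ :: _ => 0⟩

@[simp] theorem aug_mul (f g : ShuffleSeries α R) : aug (f * g) = aug f * aug g := rfl

@[simp] theorem der_mul (t : α) (f g : ShuffleSeries α R) :
    der t (f * g) = der t f * g + f * der t g := rfl

@[simp] theorem aug_one : aug (1 : ShuffleSeries α R) = 1 := rfl

@[simp] theorem der_one (t : α) : der t (1 : ShuffleSeries α R) = 0 := rfl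

private theorem mul_comm' (f g : ShuffleSeries α R) : f * g = g * f := by
  ext w
  induction w generalizing f g with
  | nil => exact mul_comm _ _
  | cons t w ih => simp only [coeff_cons, der_mul, map_add, ih (der t f), ih f, add_comm]

private theorem add_mul' (f g h : ShuffleSeries α R) : (f + g) * h = f * h + g * h := by
  ext w
  induction w generalizing f g h with
  | nil => exact add_mul _ _ _
  | cons t w ih => simp only [coeff_cons, der_mul, map_add, ih]; ring

private theorem smul_mul' (c : R) (f h : ShuffleSeries α R) : (c • f) * h = c • (f * h) := by
  ext w
  induction w generalizing f h with
  | nil => exact mul_assoc _ _ _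
  | cons t w ih => simp only [coeff_cons, der_mul, map_smul, map_add, smul_eq_mul, ih]; ring

private theorem zero_mul' (h : ShuffleSeries α R) : 0 * h = 0 := by
  simpa using smul_mul' (0 : R) 0 h

private theorem one_mul' (f : ShuffleSeries α R) : 1 * f = f := by
  ext w
  induction w generalizing f with
  | nil => exact one_mul _
  | cons t w ih => simp only [coeff_cons, der_mul, der_one, zero_mul', zero_add, ih]

private theorem mul_add' (f g h : ShuffleSeries α R) : f * (g + h) = f * g + f * h := by
  rw [mul_comm', add_mul', mul_comm' g, mul_comm' h]

private theorem mul_assoc' (f g h : ShuffleSeries α R) : f * g * h = f * (g * h) := by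
  ext w
  induction w generalizing f g h with
  | nil => exact mul_assoc _ _ _
  | cons t w ih => simp only [coeff_cons, der_mul, add_mul', mul_add', map_add, ih]; ring

instance : CommRing (ShuffleSeries α R) :=
  { (inferInstance : AddCommGroup (ShuffleSeries α R)) with
    mul_assoc := mul_assoc'
    one_mul := one_mul'
    mul_one := fun f => by rw [mul_comm', one_mul']
    left_distrib := mul_add'
    right_distrib := add_mul'
    zero_mul := zero_mul'
    mul_zero := fun f => by rw [mul_comm', zero_mul']
    mul_comm := mul_comm' }

instance : Algebra R (ShuffleSeries α R) :=
  Algebra.ofModule smul_mul' fun c f g => by rw [mul_comm, smul_mul', mul_comm]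

@[simp] theorem aug_algebraMap (c : R) : aug (algebraMap R (ShuffleSeries α R) c) = c := by
  rw [Algebra.algebraMap_eq_smul_one, map_smul, aug_one, smul_eq_mul, mul_one]

@[simp] theorem der_algebraMap (t : α) (c : R) :
    der t (algebraMap R (ShuffleSeries α R) c) = 0 := by
  rw [Algebra.algebraMap_eq_smul_one, map_smul, der_one, smul_zero]

/-- The series without constant term whose derivatives are given. -/
def prim : (α → ShuffleSeries α R) →ₗ[R] ShuffleSeries α R where
  toFun F
    | [] => 0
    | t :: w => F t w
  map_add' _ _ := ext_der (add_zero 0).symm fun _ => rfl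
  map_smul' c _ := ext_der (mul_zero c).symm fun _ => rfl

@[simp] theorem aug_prim (F : α → ShuffleSeries α R) : aug (prim F) = 0 := rfl

@[simp] theorem der_prim (F : α → ShuffleSeries α R) (t : α) : der t (prim F) = F t := rfl

/-- The half-shuffle `∫ a db`: the shuffles of `a` and `b` whose last letter comes from `b`. -/
def half : ShuffleSeries α R →ₗ[R] ShuffleSeries α R →ₗ[R] ShuffleSeries α R :=
  LinearMap.mk₂ R (fun a b => prim fun t => a * der t b)
    (fun _ _ _ => ext_der (by simp) fun _ => by simp [add_mul])
    (fun _ _ _ => ext_der (by simp) fun _ => by simp)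
    (fun _ _ _ => ext_der (by simp) fun _ => by simp [mul_add])
    (fun _ _ _ => ext_der (by simp) fun _ => by simp)

@[simp] theorem aug_half (a b : ShuffleSeries α R) : aug (half a b) = 0 := rfl

@[simp] theorem der_half (t : α) (a b : ShuffleSeries α R) : der t (half a b) = a * der t b := rfl

theorem half_add_half_swap {a b : ShuffleSeries α R} (h : aug a * aug b = 0) :
    half a b + half b a = a * b :=
  ext_der (by simp [h]) fun t => by simp only [map_add, der_half, der_mul]; ring

theorem half_half {a b : ShuffleSeries α R} (h : aug a * aug b = 0) (c : ShuffleSeries α R) :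
    half a (half b c) = half (half a b + half b a) c := by
  rw [half_add_half_swap h]
  exact ext_der (by simp) fun t => by simp [mul_assoc]

theorem half_mul_right (a b c : ShuffleSeries α R) :
    half a (b * c) = half (a * b) c + half (a * c) b :=
  ext_der (by simp) fun t => by simp only [der_half, der_mul, map_add]; ring

/-- The commutator of the half-shuffle: the signed area `∫ a db - b da`. -/
def area : ShuffleSeries α R →ₗ[R] ShuffleSeries α R →ₗ[R] ShuffleSeries α R := half - half.flip

theorem area_def (a b : ShuffleSeries α R) : area a b = half a b - half b a := rfl

@[simp] theorem aug_area (a b : ShuffleSeries α R) : aug (area a b) = 0 := by simp [area_def]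

@[simp] theorem der_area (t : α) (a b : ShuffleSeries α R) :
    der t (area a b) = a * der t b - b * der t a := by simp [area_def]

theorem half_area_right (a b c : ShuffleSeries α R) :
    half a (area b c) = half (a * b) c - half (a * c) b :=
  ext_der (by simp) fun t => by simp only [der_half, der_area, map_sub]; ring

section Letters

variable [DecidableEq α]

/-- Appending the letter `t` at the end of every word. -/
def app (t : α) : ShuffleSeries α R →ₗ[R] ShuffleSeries α R :=
  prim ∘ₗ LinearMap.single R (fun _ => ShuffleSeries α R) t

@[simp] theorem aug_app (t : α) (f : ShuffleSeries α R) : aug (app t f) = 0 := rfl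

theorem der_app (s t : α) (f : ShuffleSeries α R) :
    der s (app t f) = if s = t then f else 0 := by
  simp [app, Pi.single_apply]

@[simp] theorem der_app_self (t : α) (f : ShuffleSeries α R) : der t (app t f) = f := by
  simp [der_app]

@[simp] theorem der_app_of_ne {s t : α} (h : s ≠ t) (f : ShuffleSeries α R) :
    der s (app t f) = 0 := by
  simp [der_app, h]

theorem app_injective (t : α) : Function.Injective (app t : ShuffleSeries α R →ₗ[R] _) :=
  Function.LeftInverse.injective (der_app_self t)

theorem eq_sum_app [Fintype α] (f : ShuffleSeries α R) :
    f = algebraMap R _ (aug f) + ∑ t, app t (der t f) :=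
  ext_der (by simp) fun s => by simp [der_app]

/-- The series of the one-letter word `t`. -/
def letter (t : α) : ShuffleSeries α R := app t 1

@[simp] theorem aug_letter (t : α) : aug (letter t : ShuffleSeries α R) = 0 := rfl

theorem der_letter (s t : α) :
    der s (letter t : ShuffleSeries α R) = if s = t then 1 else 0 :=
  der_app s t 1

@[simp] theorem der_letter_self (t : α) : der t (letter t : ShuffleSeries α R) = 1 :=
  der_app_self t 1

@[simp] theorem der_letter_of_ne {s t : α} (h : s ≠ t) :
    der s (letter t : ShuffleSeries α R) = 0 :=
  der_app_of_ne h 1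

theorem half_letter_right (a : ShuffleSeries α R) (t : α) : half a (letter t) = app t a :=
  ext_der (by simp) fun s => by simp [letter, der_app]

theorem half_app_right (a b : ShuffleSeries α R) (t : α) : half a (app t b) = app t (a * b) :=
  ext_der (by simp) fun s => by simp [der_app]

end Letters

section Degree

/-- The series of degree at most `n`. Degrees are integers, so that differentiating lowers the bound
by exactly one; a series of negative degree is zero. -/
def degLE (n : ℤ) : Submodule R (ShuffleSeries α R) where
  carrier := {f | ∀ w : List α, n < w.length → coeff w f = 0}
  add_mem' hf hg w hw := by rw [map_add, hf w hw, hg w hw, add_zero]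
  zero_mem' _ _ := rfl
  smul_mem' c f hf w hw := by rw [map_smul, hf w hw, smul_zero]

theorem mem_degLE {n : ℤ} {f : ShuffleSeries α R} :
    f ∈ degLE n ↔ ∀ w : List α, n < w.length → coeff w f = 0 :=
  Iff.rfl

theorem mem_degLE_iff_der {n : ℤ} {f : ShuffleSeries α R} :
    f ∈ degLE n ↔ (n < 0 → aug f = 0) ∧ ∀ t, der t f ∈ degLE (n - 1) := by
  constructor
  · refine fun hf => ⟨fun hn => hf [] (by simpa using hn), fun t w hw => hf (t :: w) ?_⟩
    rw [List.length_cons]; push_cast; omega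
  · rintro ⟨haug, hder⟩ (_ | ⟨t, w⟩) hw
    · exact haug (by simpa using hw)
    · exact hder t w (by rw [List.length_cons] at hw; push_cast at hw; omega)

theorem degLE_mono {m n : ℤ} (h : m ≤ n) : (degLE m : Submodule R (ShuffleSeries α R)) ≤ degLE n :=
  fun _ hf w hw => hf w (h.trans_lt hw)

theorem eq_zero_of_mem_degLE {n : ℤ} (hn : n < 0) {f : ShuffleSeries α R} (hf : f ∈ degLE n) :
    f = 0 := by
  ext w; exact hf w (by omega)

theorem der_mem_degLE {n : ℤ} (t : α) {f : ShuffleSeries α R} (hf : f ∈ degLE n) :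
    der t f ∈ degLE (n - 1) :=
  (mem_degLE_iff_der.1 hf).2 t

theorem prim_mem_degLE {n : ℤ} {F : α → ShuffleSeries α R} (hF : ∀ t, F t ∈ degLE n) :
    prim F ∈ degLE (n + 1) :=
  mem_degLE_iff_der.2 ⟨fun _ => rfl, fun t => by simpa using hF t⟩

theorem algebraMap_mem_degLE (c : R) : algebraMap R (ShuffleSeries α R) c ∈ degLE 0 :=
  mem_degLE_iff_der.2 ⟨fun h => absurd h (lt_irrefl 0), fun t => by simp⟩

theorem one_mem_degLE : (1 : ShuffleSeries α R) ∈ degLE 0 := by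
  simpa using algebraMap_mem_degLE (1 : R)

theorem eq_algebraMap_of_mem_degLE_zero {f : ShuffleSeries α R} (hf : f ∈ degLE 0) :
    f = algebraMap R _ (aug f) :=
  ext_der (by simp) fun t => by
    rw [eq_zero_of_mem_degLE (by norm_num) (der_mem_degLE t hf), der_algebraMap]

theorem mul_mem_degLE {m n : ℤ} {f g : ShuffleSeries α R} (hf : f ∈ degLE m) (hg : g ∈ degLE n) :
    f * g ∈ degLE (m + n) := by
  refine mem_degLE.2 fun w hw => ?_
  induction w generalizing f g m n with
  | nil =>
    rw [List.length_nil, Nat.cast_zero] at hw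
    rw [coeff_nil, aug_mul]
    rcases lt_or_ge m 0 with hm | hm
    · rw [eq_zero_of_mem_degLE hm hf, map_zero, zero_mul]
    · rw [eq_zero_of_mem_degLE (by omega) hg, map_zero, mul_zero]
  | cons t w ih =>
    rw [List.length_cons] at hw
    push_cast at hw
    rw [coeff_cons, der_mul, map_add, ih (der_mem_degLE t hf) hg (by omega),
      ih hf (der_mem_degLE t hg) (by omega), add_zero]

theorem half_mem_degLE {m n : ℤ} {f g : ShuffleSeries α R} (hf : f ∈ degLE m) (hg : g ∈ degLE n) :
    half f g ∈ degLE (m + n) := by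
  have h := prim_mem_degLE fun t => mul_mem_degLE hf (der_mem_degLE t hg)
  rwa [add_assoc, sub_add_cancel] at h

theorem area_mem_degLE {m n : ℤ} {f g : ShuffleSeries α R} (hf : f ∈ degLE m) (hg : g ∈ degLE n) :
    area f g ∈ degLE (m + n) :=
  sub_mem (half_mem_degLE hf hg) (add_comm n m ▸ half_mem_degLE hg hf)

variable [DecidableEq α]

theorem app_mem_degLE {n : ℤ} (t : α) {f : ShuffleSeries α R} (hf : f ∈ degLE n) :
    app t f ∈ degLE (n + 1) :=
  prim_mem_degLE fun s => by
    rw [LinearMap.single_apply, Pi.single_apply]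
    split_ifs
    exacts [hf, zero_mem _]

theorem letter_mem_degLE (t : α) : (letter t : ShuffleSeries α R) ∈ degLE 1 :=
  app_mem_degLE t one_mem_degLE

end Degree

/-! ### The Euler derivation -/

section Euler

variable [DecidableEq α] [Fintype α]

/-- The Euler derivation `∑ₜ xₜ ∂ₜ` of the shuffle algebra. -/
def euler : ShuffleSeries α R →ₗ[R] ShuffleSeries α R :=
  ∑ t, LinearMap.mulLeft R (letter t) ∘ₗ der t

theorem euler_apply (f : ShuffleSeries α R) : euler f = ∑ t, letter t * der t f := by
  simp [euler]

theorem euler_mul (f g : ShuffleSeries α R) : euler (f * g) = euler f * g + f * euler g := by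
  simp only [euler_apply, Finset.sum_mul, Finset.mul_sum, ← Finset.sum_add_distrib, der_mul]
  exact Finset.sum_congr rfl fun t _ => by ring

theorem euler_app (t : α) (f : ShuffleSeries α R) : euler (app t f) = letter t * f := by
  simp [euler_apply, der_app]

theorem euler_algebraMap (c : R) : euler (algebraMap R (ShuffleSeries α R) c) = 0 := by
  simp [euler_apply]

theorem euler_letter (t : α) : euler (letter t : ShuffleSeries α R) = letter t := by
  rw [letter, euler_app, mul_one, letter]

/-- The operator `∑ xₜ₁ ⋯ xₜₖ ∂ₜ₁ ⋯ ∂ₜₖ`, the sum being over all words of length `k`. -/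
def eulerIter : ℕ → ShuffleSeries α R →ₗ[R] ShuffleSeries α R
  | 0 => LinearMap.id
  | k + 1 => ∑ t, LinearMap.mulLeft R (letter t) ∘ₗ eulerIter k ∘ₗ der t

theorem eulerIter_succ (k : ℕ) (f : ShuffleSeries α R) :
    eulerIter (k + 1) f = ∑ t, letter t * eulerIter k (der t f) := by
  simp [eulerIter]

theorem euler_eulerIter (k : ℕ) (f : ShuffleSeries α R) :
    euler (eulerIter k f) = (k : R) • eulerIter k f + eulerIter (k + 1) f := by
  induction k generalizing f with
  | zero => simp [eulerIter, euler_apply]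
  | succ k ih =>
    simp only [eulerIter_succ _ f, map_sum, euler_mul, euler_letter, ih, Finset.smul_sum,
      ← Finset.sum_add_distrib, mul_add, mul_smul_comm]
    refine Finset.sum_congr rfl fun t _ => ?_
    push_cast
    module

theorem eulerIter_eq_zero {k : ℕ} {n : ℤ} (h : n < k) {f : ShuffleSeries α R} (hf : f ∈ degLE n) :
    eulerIter k f = 0 := by
  induction k generalizing n f with
  | zero => rw [eq_zero_of_mem_degLE (by simpa using h) hf, map_zero]
  | succ k ih =>
    push_cast at h
    simp [eulerIter_succ, ih (n := n - 1) (by omega) (der_mem_degLE _ hf)]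

theorem euler_mem_degLE {n : ℤ} {f : ShuffleSeries α R} (hf : f ∈ degLE n) : euler f ∈ degLE n := by
  rw [euler_apply]
  refine sum_mem fun t _ => ?_
  simpa using mul_mem_degLE (letter_mem_degLE t) (der_mem_degLE t hf)

end Euler

theorem degLE_zero_le {N : Submodule R (ShuffleSeries α R)} (hone : 1 ∈ N) : degLE 0 ≤ N := by
  intro f hf
  rw [eq_algebraMap_of_mem_degLE_zero hf, Algebra.algebraMap_eq_smul_one]
  exact Submodule.smul_mem _ _ hone

theorem degLE_le_of_succ {G : ℤ → Submodule R (ShuffleSeries α R)} (hone : 1 ∈ G 0)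
    (hsucc : ∀ n : ℕ, degLE n ≤ G n → degLE (n + 1) ≤ G (n + 1)) (n : ℤ) : degLE n ≤ G n := by
  rcases lt_or_ge n 0 with hn | hn
  · exact fun f hf => eq_zero_of_mem_degLE hn hf ▸ zero_mem _
  lift n to ℕ using hn
  induction n with
  | zero => exact degLE_zero_le hone
  | succ n ih => exact_mod_cast hsucc n ih

theorem degLE_le_of_app_mem [DecidableEq α] [Finite α] {G : ℤ → Submodule R (ShuffleSeries α R)}
    (hG : Monotone G) (hone : 1 ∈ G 0) (happ : ∀ n t u, u ∈ G n → app t u ∈ G (n + 1)) (n : ℤ) :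
    degLE n ≤ G n := by
  cases nonempty_fintype α
  refine degLE_le_of_succ hone (fun n ih f hf => ?_) n
  rw [eq_sum_app f]
  exact add_mem (hG (by positivity) (degLE_zero_le hone (algebraMap_mem_degLE _)))
    (sum_mem fun t _ => happ n t _ (ih (by simpa using der_mem_degLE t hf)))

section AreaSubmodule

/-- The polynomials: series of bounded degree. -/
def polynomials : Submodule R (ShuffleSeries α R) where
  carrier := {f | ∃ n, f ∈ degLE n}
  add_mem' := by
    rintro f g ⟨m, hf⟩ ⟨n, hg⟩
    exact ⟨max m n, add_mem (degLE_mono (le_max_left m n) hf) (degLE_mono (le_max_right m n) hg)⟩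
  zero_mem' := ⟨0, zero_mem _⟩
  smul_mem' := by
    rintro c f ⟨n, hf⟩
    exact ⟨n, Submodule.smul_mem _ c hf⟩

theorem mem_polynomials {f : ShuffleSeries α R} : f ∈ polynomials ↔ ∃ n, f ∈ degLE n := Iff.rfl

theorem half_mem_polynomials {f g : ShuffleSeries α R} (hf : f ∈ polynomials)
    (hg : g ∈ polynomials) : half f g ∈ polynomials := by
  obtain ⟨⟨m, hf⟩, n, hg⟩ := And.intro hf hg
  exact ⟨m + n, half_mem_degLE hf hg⟩

/-- The polynomials without constant term whose second derivatives are antisymmetric: over an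
alphabet of two letters, these are the elements generated by the letters under `area`. -/
def areaSubmodule : Submodule R (ShuffleSeries α R) where
  carrier := {f | f ∈ polynomials ∧ aug f = 0 ∧ ∀ s t, der s (der t f) + der t (der s f) = 0}
  add_mem' := by
    rintro f g ⟨hf, hf0, hf2⟩ ⟨hg, hg0, hg2⟩
    refine ⟨add_mem hf hg, by rw [map_add, hf0, hg0, add_zero], fun s t => ?_⟩
    simp only [map_add]
    linear_combination hf2 s t + hg2 s t
  zero_mem' := ⟨zero_mem _, map_zero _, by simp⟩
  smul_mem' := by
    rintro c f ⟨hf, hf0, hf2⟩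
    refine ⟨Submodule.smul_mem _ c hf, by rw [map_smul, hf0, smul_zero], fun s t => ?_⟩
    simp only [map_smul, ← smul_add, hf2 s t, smul_zero]

theorem area_mem_areaSubmodule {a b : ShuffleSeries α R} (ha : a ∈ areaSubmodule)
    (hb : b ∈ areaSubmodule) : area a b ∈ areaSubmodule := by
  obtain ⟨ha, -, ha2⟩ := ha
  obtain ⟨hb, -, hb2⟩ := hb
  refine ⟨sub_mem (half_mem_polynomials ha hb) (half_mem_polynomials hb ha), aug_area a b,
    fun s t => ?_⟩
  simp only [der_area, map_sub, der_mul]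
  linear_combination a * hb2 s t - b * ha2 s t

theorem letter_mem_areaSubmodule [DecidableEq α] (t : α) :
    (letter t : ShuffleSeries α R) ∈ areaSubmodule :=
  ⟨⟨1, letter_mem_degLE t⟩, aug_letter t, fun r s => by
    simp only [letter, der_app]; split_ifs <;> simp⟩

end AreaSubmodule

section Averaging

open Finset

variable {ι : Type*} [DecidableEq ι]

theorem half_prod_right (s : Finset ι) (l : ι → ShuffleSeries α R) (a : ShuffleSeries α R) :
    half a (∏ i ∈ s, l i) = ∑ i ∈ s, half (a * ∏ j ∈ s.erase i, l j) (l i) := by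
  induction s using Finset.induction_on generalizing a with
  | empty => exact ext_der (by simp) fun t => by simp
  | insert i s hi ih =>
    rw [prod_insert hi, half_mul_right, ih, sum_insert hi, erase_insert hi, add_comm]
    congr 1
    refine sum_congr rfl fun j hj => ?_
    rw [erase_insert_of_ne (ne_of_mem_of_not_mem hj hi).symm, prod_insert (by simp [hi]), mul_assoc]

/-- Integrating by parts in turn against each factor `l i`, `half (∏ l i) m` is the average of the
product `(∏ l i) m` and of half-shuffles with one factor fewer. -/
theorem card_add_one_smul_half_prod_left (s : Finset ι) (l : ι → ShuffleSeries α R)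
    {m : ShuffleSeries α R} (hm : aug m = 0) :
    (#s + 1) • half (∏ i ∈ s, l i) m =
      (∏ i ∈ s, l i) * m + ∑ i ∈ s, half (∏ j ∈ s.erase i, l j) (area (l i) m) := by
  have hsum : ∑ i ∈ s, half (∏ j ∈ s.erase i, l j) (area (l i) m) =
      #s • half (∏ i ∈ s, l i) m - half m (∏ i ∈ s, l i) := by
    rw [half_prod_right, ← sum_const, ← sum_sub_distrib]
    refine sum_congr rfl fun i hi => ?_
    rw [half_area_right, prod_erase_mul s l hi, mul_comm m]
  rw [hsum, ← half_add_half_swap (by rw [hm, mul_zero]), succ_nsmul]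
  abel

end Averaging

section AreaIdeal

/-- `I` is an ideal of the algebra `areaSubmodule` with the product `area`. -/
structure IsAreaIdeal (I : Submodule R (ShuffleSeries α R)) : Prop where
  le : I ≤ areaSubmodule
  area_mem : ∀ {l f}, l ∈ areaSubmodule → f ∈ I → area l f ∈ I

/-- The degree `n` part of the quotient `S : I` of submodules, for the products `φ f z` of `f ∈ I`
and `z`. -/
def colon (φ : ShuffleSeries α R → ShuffleSeries α R →ₗ[R] ShuffleSeries α R)
    (I : Submodule R (ShuffleSeries α R)) (S : ℤ → Submodule R (ShuffleSeries α R)) (n : ℤ) :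
    Submodule R (ShuffleSeries α R) :=
  ⨅ (b) (f) (_ : f ∈ I ⊓ degLE b), (S (n + b)).comap (φ f)

variable {φ : ShuffleSeries α R → ShuffleSeries α R →ₗ[R] ShuffleSeries α R}
  {I : Submodule R (ShuffleSeries α R)}

theorem mem_colon {S : ℤ → Submodule R (ShuffleSeries α R)} {n : ℤ} {z : ShuffleSeries α R} :
    z ∈ colon φ I S n ↔ ∀ b, ∀ f ∈ I, f ∈ degLE b → φ f z ∈ S (n + b) := by
  simp [colon]

theorem colon_mono {S : ℤ → Submodule R (ShuffleSeries α R)} (hS : Monotone S) :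
    Monotone (colon φ I S) := fun _ _ hmn _ hz =>
  mem_colon.2 fun b f hf hb => hS (by gcongr) (mem_colon.1 hz b f hf hb)

/-- The ideal of the shuffle algebra generated by `I`, filtered by the total degree of the products
`z * f` with `f ∈ I`. -/
def shuffleIdeal (I : Submodule R (ShuffleSeries α R)) (n : ℤ) : Submodule R (ShuffleSeries α R) :=
  Submodule.span R
    {p | ∃ a b z f, a + b ≤ n ∧ z ∈ degLE a ∧ f ∈ I ∧ f ∈ degLE b ∧ z * f = p}

theorem shuffleIdeal_le {n : ℤ} {N : Submodule R (ShuffleSeries α R)}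
    (h : ∀ a b z f, a + b ≤ n → z ∈ degLE a → f ∈ I → f ∈ degLE b → z * f ∈ N) :
    shuffleIdeal I n ≤ N :=
  Submodule.span_le.2 fun _ ⟨a, b, z, f, hab, hz, hf, hb, e⟩ => e ▸ h a b z f hab hz hf hb

theorem mul_mem_shuffleIdeal {a b n : ℤ} {z f : ShuffleSeries α R} (h : a + b ≤ n)
    (hz : z ∈ degLE a) (hf : f ∈ I) (hb : f ∈ degLE b) : z * f ∈ shuffleIdeal I n :=
  Submodule.subset_span ⟨a, b, z, f, h, hz, hf, hb, rfl⟩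

theorem mem_shuffleIdeal {n : ℤ} {f : ShuffleSeries α R} (hf : f ∈ I) (hn : f ∈ degLE n) :
    f ∈ shuffleIdeal I n := by
  simpa using mul_mem_shuffleIdeal (zero_add n).le one_mem_degLE hf hn

theorem shuffleIdeal_mono : Monotone (shuffleIdeal I) := fun _ _ hmn =>
  shuffleIdeal_le fun _ _ _ _ hab => mul_mem_shuffleIdeal (hab.trans hmn)

theorem shuffleIdeal_le_degLE (n : ℤ) : shuffleIdeal I n ≤ degLE n :=
  shuffleIdeal_le fun _ _ _ _ hab hz _ hb => degLE_mono hab (mul_mem_degLE hz hb)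

theorem mul_shuffleIdeal_mem {m n : ℤ} {w p : ShuffleSeries α R} (hw : w ∈ degLE m)
    (hp : p ∈ shuffleIdeal I n) : w * p ∈ shuffleIdeal I (m + n) := by
  suffices h : shuffleIdeal I n ≤ (shuffleIdeal I (m + n)).comap (LinearMap.mulLeft R w) from h hp
  refine shuffleIdeal_le fun a b z f hab hz hf hb => ?_
  rw [Submodule.mem_comap, LinearMap.mulLeft_apply, ← mul_assoc]
  exact mul_mem_shuffleIdeal (by omega) (mul_mem_degLE hw hz) hf hb

theorem IsAreaIdeal.aug_eq_zero (hI : IsAreaIdeal I) {n : ℤ} {p : ShuffleSeries α R}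
    (hp : p ∈ shuffleIdeal I n) : aug p = 0 := by
  suffices h : shuffleIdeal I n ≤ LinearMap.ker aug from h hp
  refine shuffleIdeal_le fun a b z f _ _ hf _ => ?_
  rw [LinearMap.mem_ker, aug_mul, (hI.le hf).2.1, mul_zero]

/-- The elements of the shuffle ideal whose derivatives are in the shuffle ideal as well. -/
def derClosed (I : Submodule R (ShuffleSeries α R)) (n : ℤ) : Submodule R (ShuffleSeries α R) :=
  shuffleIdeal I n ⊓ ⨅ t, (shuffleIdeal I (n - 1)).comap (der t)

theorem mem_derClosed {n : ℤ} {q : ShuffleSeries α R} :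
    q ∈ derClosed I n ↔ q ∈ shuffleIdeal I n ∧ ∀ t, der t q ∈ shuffleIdeal I (n - 1) := by
  simp [derClosed]

theorem derClosed_mono : Monotone (derClosed I) := fun _ _ hmn _ hq =>
  mem_derClosed.2 ⟨shuffleIdeal_mono hmn (mem_derClosed.1 hq).1, fun t =>
    shuffleIdeal_mono (by omega) ((mem_derClosed.1 hq).2 t)⟩

theorem mul_derClosed_mem {m n : ℤ} {w q : ShuffleSeries α R} (hw : w ∈ degLE m)
    (hq : q ∈ derClosed I n) : w * q ∈ derClosed I (m + n) := by
  obtain ⟨hq, hder⟩ := mem_derClosed.1 hq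
  refine mem_derClosed.2 ⟨mul_shuffleIdeal_mem hw hq, fun t => ?_⟩
  rw [der_mul]
  refine add_mem ?_ ?_
  · simpa only [sub_add_eq_add_sub] using mul_shuffleIdeal_mem (der_mem_degLE t hw) hq
  · simpa only [add_sub_assoc] using mul_shuffleIdeal_mem hw (hder t)

end AreaIdeal

section Curl

/-- The commutator of the operators `app false` and `app true`. Over a two-letter alphabet it
parametrizes the elements of `areaSubmodule` without linear part. -/
def curl : ShuffleSeries Bool R →ₗ[R] ShuffleSeries Bool R :=
  app false ∘ₗ app true - app true ∘ₗ app false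

@[simp] theorem aug_curl (u : ShuffleSeries Bool R) : aug (curl u) = 0 := by simp [curl]

@[simp] theorem der_true_curl (u : ShuffleSeries Bool R) : der true (curl u) = -app false u := by
  simp [curl]

@[simp] theorem der_false_curl (u : ShuffleSeries Bool R) : der false (curl u) = app true u := by
  simp [curl]

theorem curl_mem_degLE {n : ℤ} {u : ShuffleSeries Bool R} (hu : u ∈ degLE n) :
    curl u ∈ degLE (n + 2) := by
  have h := sub_mem (app_mem_degLE false (app_mem_degLE true hu))
    (app_mem_degLE true (app_mem_degLE false hu))
  rwa [add_assoc] at h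

theorem curl_mem_areaSubmodule {u : ShuffleSeries Bool R} (hu : u ∈ polynomials) :
    curl u ∈ areaSubmodule := by
  obtain ⟨n, hu⟩ := hu
  exact ⟨⟨n + 2, curl_mem_degLE hu⟩, aug_curl u, fun s t => by cases s <;> cases t <;> simp⟩

theorem area_curl_letter (u : ShuffleSeries Bool R) (t : Bool) :
    area (curl u) (letter t) = -curl (letter t * u + app t u) := by
  refine ext_der (by simp) fun s => ext_der ?_ fun r => ?_
  · cases s <;> cases t <;> simp
  · cases s <;> cases t <;> cases r <;>
      simp only [map_add, map_sub, map_neg, map_zero, der_area, der_mul, der_one, der_false_curl,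
        der_true_curl, der_letter, der_app, Bool.false_eq_true, Bool.true_eq_false, reduceIte] <;>
      ring

theorem area_letter_true_letter_false :
    area (letter true) (letter false) = (curl 1 : ShuffleSeries Bool R) :=
  ext_der (by simp) fun s => by cases s <;> simp [letter]

end Curl

end CommRing

section Field

variable {α K : Type*} [Field K]

section Spectrum

variable [DecidableEq α] [Fintype α]

/-- The restriction of the Euler derivation to the series of degree at most `n`. -/
def eulerDegLE (n : ℤ) : Module.End K (degLE n : Submodule K (ShuffleSeries α K)) :=
  euler.restrict fun _ => euler_mem_degLE

open Polynomial in
theorem coe_aeval_eulerDegLE_descPochhammer {n : ℤ} (k : ℕ)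
    (f : (degLE n : Submodule K (ShuffleSeries α K))) :
    (aeval (eulerDegLE n) (descPochhammer K k) f : ShuffleSeries α K) = eulerIter k f := by
  induction k with
  | zero => simp [eulerIter]
  | succ k ih =>
    rw [descPochhammer_succ_right, mul_comm, map_mul, Module.End.mul_apply, map_sub, aeval_X,
      map_natCast, LinearMap.sub_apply, Submodule.coe_sub, eulerDegLE, LinearMap.coe_restrict_apply,
      ← eulerDegLE, ih, euler_eulerIter, Module.End.natCast_apply, Submodule.coe_smul_of_tower, ih,
      Nat.cast_smul_eq_nsmul, add_sub_cancel_left]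

theorem mem_range_natCast_of_mem_spectrum {n : ℤ} {c : K} (hc : c ∈ spectrum K
    (eulerDegLE n : Module.End K (degLE n : Submodule K (ShuffleSeries α K)))) :
    c ∈ Set.range (Nat.cast : ℕ → K) := by
  have haeval : Polynomial.aeval (eulerDegLE n : Module.End K (degLE (α := α) n))
      (descPochhammer K (n.toNat + 1)) = 0 := by
    ext1 f
    apply Subtype.ext
    rw [coe_aeval_eulerDegLE_descPochhammer, eulerIter_eq_zero (by push_cast; omega) f.2]
    rfl
  have hmem := spectrum.subset_polynomial_aeval _ (descPochhammer K (n.toNat + 1)) ⟨c, hc, rfl⟩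
  beta_reduce at hmem
  rw [haeval, spectrum.mem_iff, sub_zero, descPochhammer_eval_eq_prod_range] at hmem
  by_contra hrange
  refine hmem ((IsUnit.mk0 _ (Finset.prod_ne_zero_iff.2 fun j _ => ?_)).map (algebraMap K _))
  exact sub_ne_zero.2 fun h => hrange ⟨j, h.symm⟩

theorem bijOn_euler_add_smul {c : K} (hc : ∀ k : ℕ, c + k ≠ 0) (n : ℤ) :
    Set.BijOn (fun f : ShuffleSeries α K => euler f + c • f)
      (degLE n : Submodule K (ShuffleSeries α K)) (degLE n : Submodule K (ShuffleSeries α K)) := by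
  have hunit : IsUnit (algebraMap K _ (-c) - (eulerDegLE n : Module.End K (degLE (α := α) n))) := by
    by_contra h
    obtain ⟨k, hk⟩ := mem_range_natCast_of_mem_spectrum (spectrum.mem_iff.2 h)
    exact hc k (by rw [hk, add_neg_cancel])
  have hbij : Function.Bijective (eulerDegLE n + c • 1 : Module.End K (degLE (α := α) n)) := by
    rw [← Module.End.isUnit_iff, ← IsUnit.neg_iff]
    convert hunit using 1
    rw [map_neg, Algebra.algebraMap_eq_smul_one]
    abel
  refine ⟨fun f hf => add_mem (euler_mem_degLE hf) (Submodule.smul_mem _ c hf),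
    fun f hf g hg h => congrArg Subtype.val (@hbij.1 ⟨f, hf⟩ ⟨g, hg⟩ (Subtype.ext h)),
    fun f hf => ?_⟩
  obtain ⟨⟨g, hg⟩, hgf⟩ := hbij.2 ⟨f, hf⟩
  exact ⟨g, hg, congrArg Subtype.val hgf⟩

end Spectrum

/-- Since `euler + c` is surjective in each degree, its values on the series `app t u` and the
constants exhaust the polynomials. -/
theorem degLE_le_of_letter_mul_add_smul_app [DecidableEq α] [Finite α] {c : K}
    (hc : ∀ k : ℕ, c + k ≠ 0) {G : ℤ → Submodule K (ShuffleSeries α K)} (hG : Monotone G)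
    (hone : 1 ∈ G 0)
    (happ : ∀ n t u, u ∈ degLE n → u ∈ G n → letter t * u + c • app t u ∈ G (n + 1)) (n : ℤ) :
    degLE n ≤ G n := by
  cases nonempty_fintype α
  refine degLE_le_of_succ hone (fun n ih f hf => ?_) n
  obtain ⟨z, hz, rfl⟩ := (bijOn_euler_add_smul hc (n + 1)).surjOn hf
  have hder : ∀ t, der t z ∈ degLE (n : ℤ) := fun t => by simpa using der_mem_degLE t hz
  have hsum : euler z + c • z = algebraMap K _ (c * aug z) +
      ∑ t, (letter t * der t z + c • app t (der t z)) := by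
    conv_lhs => rw [euler_apply, add_comm]; arg 1; rw [eq_sum_app z]
    rw [smul_add, Finset.smul_sum, Algebra.smul_def, ← map_mul, add_assoc,
      ← Finset.sum_add_distrib]
    simp only [add_comm]
  beta_reduce
  rw [hsum]
  exact add_mem (hG (by positivity) (degLE_zero_le hone (algebraMap_mem_degLE _)))
    (sum_mem fun t _ => happ n t _ (hder t) (ih (hder t)))

/-! ### Ideals for the signed area -/

section AreaProducts

open Finset

/-- The products of elements of `areaSubmodule` of total degree at most `n`. -/
def areaProducts (n : ℤ) : Set (ShuffleSeries α K) :=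
  {c | ∃ (ι : Type) (s : Finset ι) (l : ι → ShuffleSeries α K) (d : ι → ℤ),
    (∀ i, l i ∈ areaSubmodule ⊓ degLE (d i)) ∧ ∑ i ∈ s, d i ≤ n ∧ ∏ i ∈ s, l i = c}

theorem areaProducts_mono {m n : ℤ} (h : m ≤ n) :
    (areaProducts m : Set (ShuffleSeries α K)) ⊆ areaProducts n := by
  rintro c ⟨ι, s, l, d, hl, hd, rfl⟩
  exact ⟨ι, s, l, d, hl, hd.trans h, rfl⟩

variable [CharZero K]

open Classical in
theorem half_prod_mem_span_areaProducts {ι : Type} (s : Finset ι) {l : ι → ShuffleSeries α K}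
    {d : ι → ℤ} (hl : ∀ i, l i ∈ areaSubmodule ⊓ degLE (d i)) {m : ShuffleSeries α K} {e : ℤ}
    (hm : m ∈ areaSubmodule ⊓ degLE e) :
    half (∏ i ∈ s, l i) m ∈ Submodule.span K (areaProducts (∑ i ∈ s, d i + e)) := by
  induction s using Finset.strongInduction generalizing m e with
  | H s ih =>
    have hcard : ((#s + 1 : ℕ) : K) ≠ 0 := Nat.cast_ne_zero.2 (Nat.succ_ne_zero _)
    rw [← Submodule.smul_mem_iff _ hcard, Nat.cast_smul_eq_nsmul,
      card_add_one_smul_half_prod_left s l hm.1.2.1]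
    refine add_mem (Submodule.subset_span ?_) (sum_mem fun i hi => ?_)
    · refine ⟨Option ι, insertNone s, (Option.elim · m l), (Option.elim · e d), ?_, ?_, ?_⟩
      · rintro (_ | i)
        exacts [hm, hl i]
      · simp [add_comm]
      · simp [mul_comm]
    · have h := ih (s.erase i) (erase_ssubset hi) (m := area (l i) m) (e := d i + e)
        ⟨area_mem_areaSubmodule (hl i).1 hm.1, area_mem_degLE (hl i).2 hm.2⟩
      rwa [← add_assoc, sum_erase_add s d hi] at h

theorem app_mem_span_areaProducts [DecidableEq α] (t : α) {n : ℤ} {f : ShuffleSeries α K}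
    (hf : f ∈ Submodule.span K (areaProducts n)) :
    app t f ∈ Submodule.span K (areaProducts (n + 1)) := by
  suffices h : Submodule.span K (areaProducts n) ≤
      (Submodule.span K (areaProducts (n + 1))).comap (app t) from h hf
  refine Submodule.span_le.2 ?_
  rintro c ⟨ι, s, l, d, hl, hd, rfl⟩
  rw [SetLike.mem_coe, Submodule.mem_comap, ← half_letter_right]
  refine Submodule.span_mono (areaProducts_mono (by gcongr))
    (half_prod_mem_span_areaProducts s hl ⟨letter_mem_areaSubmodule t, letter_mem_degLE t⟩)

theorem degLE_le_span_areaProducts [Finite α] (n : ℤ) :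
    degLE n ≤ Submodule.span K (areaProducts n : Set (ShuffleSeries α K)) := by
  classical
  exact degLE_le_of_app_mem (fun _ _ h => Submodule.span_mono (areaProducts_mono h))
    (Submodule.subset_span ⟨Empty, ∅, Empty.elim, Empty.elim, by simp, by simp, rfl⟩)
    (fun _ t _ h => app_mem_span_areaProducts t h) n

/-- The shuffle algebra is generated by `areaSubmodule`, compatibly with degrees. -/
theorem degLE_le_of_areaSubmodule_mul [Finite α] {G : ℤ → Submodule K (ShuffleSeries α K)}
    (hG : Monotone G) (hone : 1 ∈ G 0)
    (hmul : ∀ m n l z, l ∈ areaSubmodule → l ∈ degLE m → z ∈ G n → l * z ∈ G (m + n)) (n : ℤ) :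
    degLE n ≤ G n := by
  refine (degLE_le_span_areaProducts n).trans (Submodule.span_le.2 ?_)
  rintro c ⟨ι, s, l, d, hl, hd, rfl⟩
  refine hG hd ?_
  clear hd
  induction s using Finset.cons_induction with
  | empty => exact hone
  | cons i s hi ih =>
    rw [prod_cons, sum_cons]
    exact hmul _ _ _ _ (hl i).1 (hl i).2 ih

end AreaProducts

section AreaIdeal

variable [CharZero K] [Finite α] {I : Submodule K (ShuffleSeries α K)}

namespace IsAreaIdeal

variable (hI : IsAreaIdeal I)

include hI

theorem half_mem_shuffleIdeal {m b : ℤ} {f u : ShuffleSeries α K} (hu : u ∈ degLE m) (hf : f ∈ I)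
    (hb : f ∈ degLE b) : half f u ∈ shuffleIdeal I (m + b) := by
  classical
  suffices h : degLE m ≤ colon half I (shuffleIdeal I) m from mem_colon.1 (h hu) b f hf hb
  refine degLE_le_of_letter_mul_add_smul_app (c := 1) (fun k => by norm_cast; omega)
    (colon_mono shuffleIdeal_mono) (mem_colon.2 fun b f _ _ => ?_)
    (fun n t u hu ih => mem_colon.2 fun b f hf hb => ?_) m
  · rw [show half f 1 = 0 from ext_der (by simp) fun t => by simp]
    exact zero_mem _
  have harea : area f (letter t) ∈ I := by
    have h := neg_mem (hI.area_mem (letter_mem_areaSubmodule t) hf)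
    rwa [area_def, neg_sub, ← area_def] at h
  have hareab : area f (letter t) ∈ degLE (b + 1) := area_mem_degLE hb (letter_mem_degLE t)
  have key : half f (letter t * u + (1 : K) • app t u) =
      u * area f (letter t) - half (area f (letter t)) u + letter t * u * f := by
    refine ext_der (by simp [(hI.le hf).2.1]) fun s => ?_
    rcases eq_or_ne s t with rfl | hst
    · simp only [map_add, map_sub, one_smul, der_half, der_area, der_mul, der_letter_self,
        der_app_self]
      ring
    · simp only [map_add, map_sub, one_smul, der_half, der_area, der_mul, der_letter_of_ne hst,
        der_app_of_ne hst]
      ring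
  rw [key]
  refine add_mem (sub_mem ?_ ?_) ?_
  · exact mul_mem_shuffleIdeal (by omega) hu harea hareab
  · exact shuffleIdeal_mono (by omega) (mem_colon.1 ih (b + 1) _ harea hareab)
  · exact mul_mem_shuffleIdeal (by omega) (mul_mem_degLE (letter_mem_degLE t) hu) hf hb

theorem app_mem_shuffleIdeal [DecidableEq α] (t : α) {n : ℤ} {p : ShuffleSeries α K}
    (hp : p ∈ shuffleIdeal I n) :
    app t p ∈ shuffleIdeal I (n + 1) := by
  suffices h : shuffleIdeal I n ≤ (shuffleIdeal I (n + 1)).comap (app t) from h hp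
  refine shuffleIdeal_le fun a b z f hab hz hf hb => ?_
  rw [Submodule.mem_comap, mul_comm, ← half_app_right]
  exact shuffleIdeal_mono (by omega) (hI.half_mem_shuffleIdeal (app_mem_degLE t hz) hf hb)

theorem half_shuffleIdeal_left_mem {m n : ℤ} {p a : ShuffleSeries α K} (hp : p ∈ shuffleIdeal I n)
    (ha : a ∈ degLE m) : half p a ∈ shuffleIdeal I (m + n) := by
  classical
  cases nonempty_fintype α
  rw [eq_sum_app (half p a), aug_half, map_zero, zero_add]
  refine sum_mem fun t _ => ?_
  have h := hI.app_mem_shuffleIdeal t (mul_shuffleIdeal_mem (der_mem_degLE t ha) hp)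
  rwa [mul_comm, ← der_half, sub_add_eq_add_sub, sub_add_cancel] at h

theorem half_shuffleIdeal_right_mem {m n : ℤ} {a p : ShuffleSeries α K} (ha : a ∈ degLE m)
    (hp : p ∈ shuffleIdeal I n) : half a p ∈ shuffleIdeal I (m + n) := by
  rw [eq_sub_of_add_eq (half_add_half_swap (by rw [hI.aug_eq_zero hp, mul_zero]))]
  exact sub_mem (mul_shuffleIdeal_mem ha hp) (hI.half_shuffleIdeal_left_mem hp ha)

theorem half_mem_derClosed {a b : ℤ} {f l : ShuffleSeries α K} (hl : l ∈ degLE a) (hf : f ∈ I)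
    (hb : f ∈ degLE b) : half f l ∈ derClosed I (a + b) := by
  refine mem_derClosed.2 ⟨hI.half_mem_shuffleIdeal hl hf hb, fun t => ?_⟩
  rw [der_half, mul_comm]
  exact mul_mem_shuffleIdeal (by omega) (der_mem_degLE t hl) hf hb

theorem shuffleIdeal_le_sup_derClosed (n : ℤ) : shuffleIdeal I n ≤ I ⊔ derClosed I n := by
  have hmono : Monotone fun n => I ⊔ derClosed I n := fun m n hmn =>
    sup_le_sup le_rfl (derClosed_mono hmn)
  suffices h : ∀ m, degLE m ≤
      colon (LinearMap.mulLeft K) I (fun n => I ⊔ derClosed I n) m ⊓ degLE m by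
    refine shuffleIdeal_le fun a b z f hab hz hf hb => ?_
    rw [mul_comm]
    exact hmono hab (mem_colon.1 (h a hz).1 b f hf hb)
  refine degLE_le_of_areaSubmodule_mul
    (fun m n hmn => inf_le_inf (colon_mono hmono hmn) (degLE_mono hmn))
    ⟨mem_colon.2 fun b f hf _ => ?_, one_mem_degLE⟩ fun m n l z hl hm hz =>
      ⟨mem_colon.2 fun b f hf hb => ?_, mul_mem_degLE hm hz.2⟩
  · rw [LinearMap.mulLeft_apply, mul_one]
    exact Submodule.mem_sup_left hf
  have key : f * (l * z) = area l f * z + (2 : K) • (z * half f l) := by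
    rw [area_def, two_smul]
    linear_combination (-z) * half_add_half_swap (a := l) (b := f) (by simp [hl.2.1])
  rw [LinearMap.mulLeft_apply, key, show m + n + b = n + (m + b) by ring]
  exact add_mem (mem_colon.1 hz.1 _ _ (hI.area_mem hl hf) (area_mem_degLE hm hb))
    (Submodule.smul_mem _ _
      (Submodule.mem_sup_right (mul_derClosed_mem hz.2 (hI.half_mem_derClosed hm hf hb))))

end IsAreaIdeal

end AreaIdeal

section Curl

variable [NeZero (2 : K)]

theorem der_der_self {f : ShuffleSeries α K} (hf : f ∈ areaSubmodule) (t : α) :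
    der t (der t f) = 0 := by
  have h : (2 : K) • der t (der t f) = 0 := by rw [two_smul]; exact hf.2.2 t t
  exact (smul_eq_zero.1 h).resolve_left two_ne_zero

theorem der_false_eq {f : ShuffleSeries Bool K} (hf : f ∈ areaSubmodule) :
    der false f = algebraMap K _ (aug (der false f)) + app true (der true (der false f)) := by
  conv_lhs => rw [eq_sum_app (der false f), Fintype.sum_bool, der_der_self hf]
  simp

theorem der_true_eq {f : ShuffleSeries Bool K} (hf : f ∈ areaSubmodule) :
    der true f = algebraMap K _ (aug (der true f)) - app false (der true (der false f)) := by
  have hswap : der false (der true f) = -der true (der false f) :=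
    eq_neg_of_add_eq_zero_left (hf.2.2 _ _)
  conv_lhs => rw [eq_sum_app (der true f), Fintype.sum_bool, der_der_self hf, hswap]
  simp [sub_eq_add_neg]

theorem eq_curl_add_of_mem_areaSubmodule {f : ShuffleSeries Bool K} (hf : f ∈ areaSubmodule) :
    f = curl (der true (der false f)) + ∑ t, aug (der t f) • letter t := by
  refine ext_der (by simp [hf.2.1]) fun s => ?_
  cases s
  · conv_lhs => rw [der_false_eq hf]
    simp [Algebra.algebraMap_eq_smul_one, add_comm]
  · conv_lhs => rw [der_true_eq hf]
    simp [Algebra.algebraMap_eq_smul_one, sub_eq_neg_add]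

theorem eq_curl_of_aug_der_eq_zero {f : ShuffleSeries Bool K} (hf : f ∈ areaSubmodule)
    (h : ∀ t, aug (der t f) = 0) : f = curl (der true (der false f)) := by
  conv_lhs => rw [eq_curl_add_of_mem_areaSubmodule hf]
  simp [h]

theorem area_curl_area_letter_sub {f u : ShuffleSeries Bool K} (hf : f ∈ areaSubmodule)
    (hu : u ∈ polynomials) (t : Bool) :
    area (curl u) (area (letter t) f) - area (letter t) (area (curl u) f) =
      curl (f * (letter t * u + (2 : K) • app t u) - area (letter t) f * u) := by
  have hc := curl_mem_areaSubmodule hu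
  have ht := letter_mem_areaSubmodule (R := K) t
  have hm : area (curl u) (area (letter t) f) - area (letter t) (area (curl u) f) ∈ areaSubmodule :=
    sub_mem (area_mem_areaSubmodule hc (area_mem_areaSubmodule ht hf))
      (area_mem_areaSubmodule ht (area_mem_areaSubmodule hc hf))
  rw [eq_curl_of_aug_der_eq_zero hm]
  · congr 1
    cases t <;>
      simp only [map_sub, map_zero, two_smul, der_area, der_mul, der_one, der_false_curl,
        der_true_curl, der_letter, der_app, Bool.false_eq_true, Bool.true_eq_false, reduceIte] <;>
      ring
  · intro s
    cases s <;> cases t <;> simp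

theorem area_letter_area_letter_sub {f : ShuffleSeries Bool K} (hf : f ∈ areaSubmodule) :
    area (letter true) (area (letter false) f) - area (letter false) (area (letter true) f) =
      -(2 : K) • curl f := by
  have ht := fun t => letter_mem_areaSubmodule (R := K) (t : Bool)
  have hm : area (letter true) (area (letter false) f) -
      area (letter false) (area (letter true) f) ∈ areaSubmodule :=
    sub_mem (area_mem_areaSubmodule (ht _) (area_mem_areaSubmodule (ht _) hf))
      (area_mem_areaSubmodule (ht _) (area_mem_areaSubmodule (ht _) hf))
  rw [eq_curl_of_aug_der_eq_zero hm, ← map_smul]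
  · congr 1
    simp only [map_sub, map_zero, neg_smul, two_smul, der_area, der_mul, der_one,
      der_letter, Bool.false_eq_true, Bool.true_eq_false, reduceIte]
    ring
  · intro s
    cases s <;> simp [hf.2.1]

end Curl

theorem curl_mem_of_area_letter_mem [CharZero K] {N : Submodule K (ShuffleSeries Bool K)}
    (hone : curl 1 ∈ N) (harea : ∀ f ∈ N, ∀ t, area f (letter t) ∈ N) {n : ℤ}
    {z : ShuffleSeries Bool K} (hz : z ∈ degLE n) : curl z ∈ N := by
  suffices h : degLE n ≤ N.comap curl from h hz
  refine degLE_le_of_letter_mul_add_smul_app (c := 1) (G := fun _ => N.comap curl)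
    (fun k => by norm_cast; omega) monotone_const hone (fun n t u _ ih => ?_) n
  have h := harea _ ih t
  rwa [area_curl_letter, neg_mem_iff, ← one_smul K (app t u)] at h

namespace IsAreaIdeal

variable [CharZero K] {I : Submodule K (ShuffleSeries Bool K)} (hI : IsAreaIdeal I)

include hI

theorem curl_mul_mem {n : ℤ} {f z : ShuffleSeries Bool K} (hz : z ∈ degLE n) (hf : f ∈ I) :
    curl (f * z) ∈ I := by
  suffices h : degLE n ≤ colon (fun f => curl ∘ₗ LinearMap.mulLeft K f) I (fun _ => I) n by
    obtain ⟨b, hb⟩ := (hI.le hf).1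
    exact mem_colon.1 (h hz) b f hf hb
  refine degLE_le_of_letter_mul_add_smul_app (c := 2) (fun k => by norm_cast; omega)
    (colon_mono monotone_const) (mem_colon.2 fun b f hf _ => ?_)
    (fun n t u hu ih => mem_colon.2 fun b f hf hb => ?_) n
  · have hl : ∀ s t, area (letter s) (area (letter t) f) ∈ I := fun s t =>
      hI.area_mem (letter_mem_areaSubmodule s) (hI.area_mem (letter_mem_areaSubmodule t) hf)
    have h := sub_mem (hl true false) (hl false true)
    rw [area_letter_area_letter_sub (hI.le hf)] at h
    rw [LinearMap.comp_apply, LinearMap.mulLeft_apply, mul_one]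
    exact (Submodule.smul_mem_iff _ (neg_ne_zero.2 two_ne_zero)).1 h
  · have hc := curl_mem_areaSubmodule (mem_polynomials.2 ⟨n, hu⟩)
    have ht := letter_mem_areaSubmodule (R := K) t
    have harea := mem_colon.1 ih (1 + b) _ (hI.area_mem ht hf)
      (area_mem_degLE (letter_mem_degLE t) hb)
    have key := area_curl_area_letter_sub (hI.le hf) (mem_polynomials.2 ⟨n, hu⟩) t
    rw [map_sub, eq_sub_iff_add_eq] at key
    rw [LinearMap.comp_apply, LinearMap.mulLeft_apply, ← key]
    exact add_mem (sub_mem (hI.area_mem hc (hI.area_mem ht hf))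
      (hI.area_mem ht (hI.area_mem hc hf))) harea

theorem curl_mem {n : ℤ} {p : ShuffleSeries Bool K} (hp : p ∈ shuffleIdeal I n) : curl p ∈ I := by
  suffices h : shuffleIdeal I n ≤ I.comap curl from h hp
  refine shuffleIdeal_le fun a b z f _ hz hf _ => ?_
  rw [Submodule.mem_comap, mul_comm]
  exact hI.curl_mul_mem hz hf

theorem curl_mem_of_letter_mem (hx : letter true ∈ I) {n : ℤ} {z : ShuffleSeries Bool K}
    (hz : z ∈ degLE n) : curl z ∈ I := by
  have hswap {f : ShuffleSeries Bool K} (hf : f ∈ I) (t : Bool) : area f (letter t) ∈ I := by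
    rw [area_def, ← neg_sub, ← area_def]
    exact neg_mem (hI.area_mem (letter_mem_areaSubmodule t) hf)
  refine curl_mem_of_area_letter_mem ?_ (fun f hf t => hswap hf t) hz
  rw [← area_letter_true_letter_false]
  exact hswap hx false

theorem mem_of_app_mem (hx : letter true ∉ I) {n : ℤ} {r : ShuffleSeries Bool K}
    (hr : app true r ∈ shuffleIdeal I n) : r ∈ shuffleIdeal I (n - 1) := by
  induction h : n.toNat generalizing n r with
  | zero =>
    have hdeg := der_mem_degLE true (shuffleIdeal_le_degLE n hr)
    rw [der_app_self] at hdeg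
    exact eq_zero_of_mem_degLE (by omega) hdeg ▸ zero_mem _
  | succ k ih =>
    obtain ⟨i, hi, q, hq, hiq⟩ := Submodule.mem_sup.1 (hI.shuffleIdeal_le_sup_derClosed n hr)
    have hder := (mem_derClosed.1 hq).2
    have hderi : der false i ∈ shuffleIdeal I (n - 1) := by
      have h := congrArg (der false) hiq
      rw [map_add, der_app_of_ne Bool.false_ne_true] at h
      rw [eq_neg_of_add_eq_zero_left h]
      exact neg_mem (hder false)
    have haug := hI.aug_eq_zero hderi
    have hd : der true (der false i) ∈ shuffleIdeal I (n - 1 - 1) := by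
      rw [der_false_eq (hI.le hi), haug, map_zero, zero_add] at hderi
      exact ih hderi (by omega)
    have haug' : aug (der true i) = 0 := by
      have hi' := hi
      rw [eq_curl_add_of_mem_areaSubmodule (hI.le hi), Fintype.sum_bool, haug, zero_smul, add_zero,
        Submodule.add_mem_iff_right _ (hI.curl_mem hd)] at hi'
      exact by_contra fun h => hx ((Submodule.smul_mem_iff _ h).1 hi')
    rw [← der_app_self true r, ← hiq, map_add, der_true_eq (hI.le hi), haug', map_zero, zero_sub]
    refine add_mem (neg_mem ?_) (hder true)
    simpa only [sub_add_cancel] using hI.app_mem_shuffleIdeal false hd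

theorem mem_of_mem_shuffleIdeal {n : ℤ} {p : ShuffleSeries Bool K} (hp : p ∈ shuffleIdeal I n)
    (hparea : p ∈ areaSubmodule) : p ∈ I := by
  obtain ⟨i, hi, q, hq, rfl⟩ := Submodule.mem_sup.1 (hI.shuffleIdeal_le_sup_derClosed n hp)
  obtain ⟨hqn, hder⟩ := mem_derClosed.1 hq
  have hqarea : q ∈ areaSubmodule := by simpa using sub_mem hparea (hI.le hi)
  have haug : ∀ t, aug (der t q) = 0 := fun t => hI.aug_eq_zero (hder t)
  rw [eq_curl_of_aug_der_eq_zero hqarea haug]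
  refine add_mem hi ?_
  by_cases hx : letter true ∈ I
  · exact hI.curl_mem_of_letter_mem hx
      (der_mem_degLE true (der_mem_degLE false (shuffleIdeal_le_degLE n hqn)))
  · have hq' := hder false
    rw [der_false_eq hqarea, haug, map_zero, zero_add] at hq'
    exact hI.curl_mem (hI.mem_of_app_mem hx hq')

end IsAreaIdeal

/-! ### Algebras mapping to the area algebra -/

section AreaHom

/-- The sum of the terms `letter t * u t + app t (u t)` is the image of `∑ t, app t (u t)` under the
injective operator `euler + 1`, which fixes the constants. -/
theorem eq_zero_of_algebraMap_eq_sum [CharZero K] [DecidableEq α] [Fintype α] {c : K}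
    {u : α → ShuffleSeries α K} (hu : ∀ t, u t ∈ polynomials)
    (h : algebraMap K _ c = ∑ t, (letter t * u t + app t (u t))) : c = 0 ∧ ∀ t, u t = 0 := by
  obtain ⟨n, hn⟩ : algebraMap K _ c - ∑ t, app t (u t) ∈ polynomials :=
    sub_mem ⟨0, algebraMap_mem_degLE c⟩ (sum_mem fun t _ =>
      let ⟨n, hn⟩ := hu t; ⟨n + 1, app_mem_degLE t hn⟩)
  have hzero : algebraMap K _ c - ∑ t, app t (u t) = 0 := by
    refine (bijOn_euler_add_smul (c := (1 : K)) (fun k => by norm_cast; omega) n).injOn hn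
      (zero_mem _) ?_
    simp only [map_sub, map_sum, euler_app, euler_algebraMap, one_smul, map_zero, add_zero]
    rw [h, Finset.sum_add_distrib]
    abel
  refine ⟨by simpa using congrArg aug hzero, fun s => ?_⟩
  simpa [der_app] using congrArg (der s) hzero

theorem curl_injective : Function.Injective (curl : ShuffleSeries Bool K →ₗ[K] _) :=
  fun u v h => app_injective false (neg_injective (by simpa using congrArg (der true) h))

theorem eq_areaSubmodule_of_letter_mem [CharZero K]
    {N : Submodule K (ShuffleSeries Bool K)}
    (hN : N ≤ areaSubmodule) (hletter : ∀ t, letter t ∈ N)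
    (harea : ∀ f ∈ N, ∀ t, area f (letter t) ∈ N) : N = areaSubmodule := by
  refine le_antisymm hN fun f hf => ?_
  obtain ⟨n, hn⟩ := hf.1
  rw [eq_curl_add_of_mem_areaSubmodule hf]
  refine add_mem (curl_mem_of_area_letter_mem ?_ harea (der_mem_degLE _ (der_mem_degLE _ hn)))
    (sum_mem fun t _ => Submodule.smul_mem _ _ (hletter t))
  rw [← area_letter_true_letter_false]
  exact harea _ (hletter true) false

variable {E : Type*} [NonUnitalNonAssocRing E] [Module K E] {g : Bool → E}
  {F : E →ₗ[K] ShuffleSeries Bool K} (hmul : ∀ p q, F (p * q) = area (F p) (F q))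
  (hletter : ∀ t, F (g t) = letter t)

include hmul hletter

theorem exists_curl_eq_of_mem_leftNormedSpan {p : E} (hp : p ∈ leftNormedSpan K g) :
    ∃ u ∈ polynomials, curl u = F p := by
  suffices h : leftNormedSpan K g ≤ (polynomials.map curl).comap F from h hp
  refine Submodule.span_le.2 ?_
  rintro _ ⟨w, rfl⟩
  induction w with
  | nil =>
    refine ⟨1, ⟨0, one_mem_degLE⟩, ?_⟩
    rw [leftNormed, hmul, hletter, hletter, area_letter_true_letter_false]
  | cons t w ih =>
    obtain ⟨u, ⟨n, hu⟩, hFu⟩ := ih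
    refine ⟨-(letter t * u + app t u), ⟨n + 1, neg_mem (add_mem ?_ (app_mem_degLE t hu))⟩, ?_⟩
    · exact add_comm 1 n ▸ mul_mem_degLE (letter_mem_degLE t) hu
    · rw [leftNormed, hmul, hletter, ← hFu, area_curl_letter, map_neg]

variable [CharZero K] [IsScalarTower K E E]

theorem eq_zero_of_mem_leftNormedSpanLT {n : ℕ} {p : E} (hp : p ∈ leftNormedSpanLT K g n)
    (h : F p = 0) : p = 0 := by
  induction n generalizing p with
  | zero => simpa [leftNormedSpanLT] using hp
  | succ n ih =>
    obtain ⟨c, q, hq, rfl⟩ := exists_eq_smul_add_sum_mul hp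
    choose u hu hqu using fun t => exists_curl_eq_of_mem_leftNormedSpan hmul hletter
      (leftNormedSpanLT_le n (hq t))
    have hcurl : curl (algebraMap K _ c - ∑ t, (letter t * u t + app t (u t))) = 0 := by
      rw [← h]
      simp only [map_add, map_sub, map_sum, map_smul, leftNormed, hmul, hletter, ← hqu,
        area_curl_letter, area_letter_true_letter_false, Algebra.algebraMap_eq_smul_one,
        Finset.sum_neg_distrib]
      exact sub_eq_add_neg _ _
    obtain ⟨hc, hu0⟩ := eq_zero_of_algebraMap_eq_sum hu
      (sub_eq_zero.1 (curl_injective (hcurl.trans (map_zero curl).symm)))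
    have hq0 : ∀ t, q t = 0 := fun t => ih (hq t) (by rw [← hqu, hu0, map_zero])
    simp [hc, hq0]

variable [SMulCommClass K E E]

theorem map_adjoin_range_eq_areaSubmodule :
    (NonUnitalAlgebra.adjoin K (Set.range g)).toSubmodule.map F = areaSubmodule := by
  have hgen (t : Bool) : g t ∈ NonUnitalAlgebra.adjoin K (Set.range g) :=
    NonUnitalAlgebra.subset_adjoin K ⟨t, rfl⟩
  refine eq_areaSubmodule_of_letter_mem ?_ (fun t => ⟨g t, hgen t, hletter t⟩) ?_
  · rintro _ ⟨p, hp, rfl⟩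
    induction hp using NonUnitalAlgebra.adjoin_induction with
    | mem p hp => obtain ⟨t, rfl⟩ := hp; exact hletter t ▸ letter_mem_areaSubmodule t
    | zero => exact map_zero F ▸ zero_mem _
    | add p q _ _ hp hq => exact map_add F p q ▸ add_mem hp hq
    | smul c p _ hp => exact map_smul F c p ▸ Submodule.smul_mem _ c hp
    | mul p q _ _ hp hq => exact hmul p q ▸ area_mem_areaSubmodule hp hq
  · rintro _ ⟨p, hp, rfl⟩ t
    exact ⟨p * g t, mul_mem (S := NonUnitalSubalgebra K E) hp (hgen t), by rw [hmul, hletter]⟩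

theorem eq_zero_of_mem_adjoin_range (hE : IsTortkara E) {p : E}
    (hp : p ∈ NonUnitalAlgebra.adjoin K (Set.range g)) (h : F p = 0) : p = 0 := by
  obtain ⟨l, hl, q, hq, rfl⟩ := Submodule.mem_sup.1 (hE.adjoin_range_le_sup_leftNormedSpan hp)
  obtain ⟨c, rfl⟩ := (Submodule.mem_span_range_iff_exists_fun K).1 hl
  obtain ⟨n, hn⟩ := exists_mem_leftNormedSpanLT hq
  obtain ⟨u, -, hu⟩ := exists_curl_eq_of_mem_leftNormedSpan hmul hletter hq
  have hc : ∀ t, c t = 0 := fun t => by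
    rw [map_add, ← hu, map_sum] at h
    have h := congrArg (fun f => aug (der t f)) h
    cases t <;> simpa [hletter] using h
  simp only [hc, zero_smul, Finset.sum_const_zero, zero_add] at h ⊢
  exact eq_zero_of_mem_leftNormedSpanLT hmul hletter hn h

variable {J : Submodule K E}

theorem isAreaIdeal_map_inf (hJ : ∀ q, ∀ p ∈ J, q * p ∈ J) :
    IsAreaIdeal (((NonUnitalAlgebra.adjoin K (Set.range g)).toSubmodule ⊓ J).map F) where
  le := (Submodule.map_mono inf_le_left).trans (map_adjoin_range_eq_areaSubmodule hmul hletter).le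
  area_mem := by
    rintro l _ hl ⟨p, ⟨hp, hpJ⟩, rfl⟩
    rw [← map_adjoin_range_eq_areaSubmodule hmul hletter] at hl
    obtain ⟨q, hq, rfl⟩ := hl
    exact ⟨q * p, ⟨mul_mem (S := NonUnitalSubalgebra K E) hq hp, hJ q p hpJ⟩, hmul q p⟩

theorem map_mem_map_inf_iff (hE : IsTortkara E) {p : E}
    (hp : p ∈ NonUnitalAlgebra.adjoin K (Set.range g)) :
    F p ∈ ((NonUnitalAlgebra.adjoin K (Set.range g)).toSubmodule ⊓ J).map F ↔ p ∈ J := by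
  refine ⟨?_, fun h => ⟨p, ⟨hp, h⟩, rfl⟩⟩
  rintro ⟨q, ⟨hq, hqJ⟩, hqp⟩
  have h := eq_zero_of_mem_adjoin_range hmul hletter hE (sub_mem hq hp)
    (by rw [map_sub, hqp, sub_self])
  exact sub_eq_zero.1 h ▸ hqJ

end AreaHom

end Field

end ShuffleSeries

open ShuffleSeries

/-! ### The free Zinbiel algebra -/

/-- The free Zinbiel algebra on `α`: the polynomials without constant term, with the half-shuffle as
product. -/
def HalfShuffleAlgebra (α R : Type*) [CommRing R] : Type _ :=
  (polynomials ⊓ LinearMap.ker aug : Submodule R (ShuffleSeries α R))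

namespace HalfShuffleAlgebra

section CommRing

variable {α R : Type*} [CommRing R]

instance : AddCommGroup (HalfShuffleAlgebra α R) :=
  inferInstanceAs (AddCommGroup (polynomials ⊓ LinearMap.ker aug : Submodule R (ShuffleSeries α R)))

instance : Module R (HalfShuffleAlgebra α R) :=
  inferInstanceAs (Module R (polynomials ⊓ LinearMap.ker aug : Submodule R (ShuffleSeries α R)))

/-- The inclusion into the space of series. -/
def toSeries : HalfShuffleAlgebra α R →ₗ[R] ShuffleSeries α R :=
  (polynomials ⊓ LinearMap.ker aug).subtype

theorem toSeries_injective : Function.Injective (toSeries : HalfShuffleAlgebra α R →ₗ[R] _) :=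
  Subtype.val_injective

theorem toSeries_mem_polynomials (a : HalfShuffleAlgebra α R) : toSeries a ∈ polynomials := a.2.1

theorem aug_toSeries (a : HalfShuffleAlgebra α R) : aug (toSeries a) = 0 := a.2.2

instance : Mul (HalfShuffleAlgebra α R) where
  mul a b := ⟨half (toSeries a) (toSeries b),
    half_mem_polynomials (toSeries_mem_polynomials a) (toSeries_mem_polynomials b), aug_half _ _⟩

theorem toSeries_mul (a b : HalfShuffleAlgebra α R) :
    toSeries (a * b) = half (toSeries a) (toSeries b) := rfl

instance : NonUnitalNonAssocRing (HalfShuffleAlgebra α R) :=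
  { (inferInstance : AddCommGroup (HalfShuffleAlgebra α R)) with
    left_distrib := fun _ _ _ => toSeries_injective (by simp [toSeries_mul])
    right_distrib := fun _ _ _ => toSeries_injective (by simp [toSeries_mul])
    zero_mul := fun _ => toSeries_injective (by simp [toSeries_mul])
    mul_zero := fun _ => toSeries_injective (by simp [toSeries_mul]) }

instance : IsScalarTower R (HalfShuffleAlgebra α R) (HalfShuffleAlgebra α R) where
  smul_assoc _ _ _ := toSeries_injective (by simp [toSeries_mul])

instance : SMulCommClass R (HalfShuffleAlgebra α R) (HalfShuffleAlgebra α R) where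
  smul_comm _ _ _ := toSeries_injective (by simp [toSeries_mul])

theorem isZinbiel : IsZinbiel (HalfShuffleAlgebra α R) := fun a b c => toSeries_injective <| by
  simp only [toSeries_mul, map_add]
  rw [half_half (by rw [aug_toSeries, zero_mul]), map_add, LinearMap.add_apply]

/-- The free generator corresponding to the letter `t`. -/
def gen [DecidableEq α] (t : α) : HalfShuffleAlgebra α R :=
  ⟨letter t, ⟨1, letter_mem_degLE t⟩, aug_letter t⟩

theorem toSeries_gen [DecidableEq α] (t : α) :
    toSeries (gen t : HalfShuffleAlgebra α R) = letter t := rfl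

/-- The inclusion of the minus-algebra into the space of series. -/
def minusToSeries : MinusAlgebra (HalfShuffleAlgebra α R) →ₗ[R] ShuffleSeries α R where
  toFun a := toSeries (MinusAlgebra.of.symm a)
  map_add' _ _ := rfl
  map_smul' _ _ := rfl

theorem minusToSeries_mul (a b : MinusAlgebra (HalfShuffleAlgebra α R)) :
    minusToSeries (a * b) = area (minusToSeries a) (minusToSeries b) := rfl

/-- The ideal of the Zinbiel algebra cut out by the shuffle ideal generated by `I`. -/
def zinbielIdeal (I : Submodule R (ShuffleSeries α R)) : Submodule R (HalfShuffleAlgebra α R) :=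
  (⨆ n, shuffleIdeal I n).comap toSeries

theorem mem_zinbielIdeal {I : Submodule R (ShuffleSeries α R)} {a : HalfShuffleAlgebra α R} :
    a ∈ zinbielIdeal I ↔ ∃ n, toSeries a ∈ shuffleIdeal I n :=
  Submodule.mem_iSup_of_directed _ shuffleIdeal_mono.directed_le

end CommRing

variable {α K : Type*} [Field K] [CharZero K]

section ZinbielIdeal

variable [Finite α] {I : Submodule K (ShuffleSeries α K)} (hI : IsAreaIdeal I)

include hI

theorem mul_mem_zinbielIdeal_left {p : HalfShuffleAlgebra α K} (hp : p ∈ zinbielIdeal I)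
    (a : HalfShuffleAlgebra α K) : p * a ∈ zinbielIdeal I := by
  obtain ⟨⟨n, hn⟩, m, hm⟩ := And.intro (mem_zinbielIdeal.1 hp) (toSeries_mem_polynomials a)
  exact mem_zinbielIdeal.2 ⟨m + n, hI.half_shuffleIdeal_left_mem hn hm⟩

theorem mul_mem_zinbielIdeal_right (a : HalfShuffleAlgebra α K) {p : HalfShuffleAlgebra α K}
    (hp : p ∈ zinbielIdeal I) : a * p ∈ zinbielIdeal I := by
  obtain ⟨⟨n, hn⟩, m, hm⟩ := And.intro (mem_zinbielIdeal.1 hp) (toSeries_mem_polynomials a)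
  exact mem_zinbielIdeal.2 ⟨m + n, hI.half_shuffleIdeal_right_mem hm hn⟩

end ZinbielIdeal

theorem mem_zinbielIdeal_iff {I : Submodule K (ShuffleSeries Bool K)} (hI : IsAreaIdeal I)
    {a : HalfShuffleAlgebra Bool K} (ha : toSeries a ∈ areaSubmodule) :
    a ∈ zinbielIdeal I ↔ toSeries a ∈ I := by
  refine mem_zinbielIdeal.trans ⟨fun ⟨n, hn⟩ => hI.mem_of_mem_shuffleIdeal hn ha, fun h => ?_⟩
  obtain ⟨n, hn⟩ := ha.1
  exact ⟨n, mem_shuffleIdeal h hn⟩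

end HalfShuffleAlgebra

open HalfShuffleAlgebra in
theorem IsTortkara.isSpecial_of_adjoin_range_eq_top {K : Type u} {B : Type v} [Field K] [CharZero K]
    [NonUnitalNonAssocRing B] [Module K B] [IsScalarTower K B B] [SMulCommClass K B B]
    (hB : IsTortkara B) {g : Bool → B} (hg : NonUnitalAlgebra.adjoin K (Set.range g) = ⊤) :
    IsSpecial K B := by
  let A := MinusAlgebra (HalfShuffleAlgebra Bool K)
  let pair : Bool → A × B := fun t => (MinusAlgebra.of (gen t), g t)
  let S := NonUnitalAlgebra.adjoin K (Set.range pair)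
  let F : A × B →ₗ[K] ShuffleSeries Bool K := minusToSeries ∘ₗ LinearMap.fst K A B
  let snd := NonUnitalAlgHom.snd K A B
  have hmul (p q : A × B) : F (p * q) = area (F p) (F q) := minusToSeries_mul p.1 q.1
  have hletter (t : Bool) : F (pair t) = letter t := toSeries_gen t
  have hI := isAreaIdeal_map_inf (J := LinearMap.ker (LinearMap.snd K A B)) hmul hletter
    fun q p (hp : p.2 = 0) => show q.2 * p.2 = 0 by rw [hp, mul_zero]
  obtain ⟨Q, _, _, _, _, π, hπ, hker⟩ := exists_surjective_nonUnitalAlgHom_of_ideal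
    (zinbielIdeal _) (fun a _ hp => mul_mem_zinbielIdeal_right hI a hp)
    (fun _ => mul_mem_zinbielIdeal_left hI)
  have hsurj : Function.Surjective (snd.comp (NonUnitalSubalgebraClass.subtype S)) :=
    surjective_comp_subtype_adjoin (by rw [← Set.range_comp]; exact hg)
  have hiff (p : S) : MinusAlgebra.map π p.1.1 = 0 ↔ snd p = 0 := by
    have hp : F p ∈ areaSubmodule := by
      rw [← map_adjoin_range_eq_areaSubmodule hmul hletter]
      exact ⟨p, p.2, rfl⟩
    exact (hker _).trans <| (mem_zinbielIdeal_iff hI hp).trans <|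
      map_mem_map_inf_iff hmul hletter (isZinbiel.isTortkara_minusAlgebra.prod hB) p.2
  obtain ⟨f, hf⟩ := exists_injective_nonUnitalAlgHom_of_surjective hsurj
    (ψ := (MinusAlgebra.map π).comp ((NonUnitalAlgHom.fst K A B).comp
      (NonUnitalSubalgebraClass.subtype S))) hiff
  exact (isZinbiel.of_surjective hπ).isSpecial hf

theorem mainTheorem5 (K : Type u) (B : Type v) [Field K] [CharZero K]
    [NonUnitalNonAssocRing B] [Module K B] [IsScalarTower K B B] [SMulCommClass K B B]
    (hB : IsTortkara B)
    (hgen : ∃ x y : B, NonUnitalAlgebra.adjoin K ({x, y} : Set B) = ⊤) :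
    IsSpecial K B := by
  obtain ⟨x, y, hxy⟩ := hgen
  have hrange : Set.range (fun t : Bool => bif t then x else y) = {x, y} := by
    ext b; simp [eq_comm, or_comm]
  exact hB.isSpecial_of_adjoin_range_eq_top (hrange ▸ hxy)
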